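/- Consider the two-user Gaussian MISO broadcast channel with $M$ transmit antennas, $y_t=\boldsymbol h_t^{\mathsf T}\boldsymbol x_t+e_t$, $z_t=\boldsymbol g_t^{\mathsf T}\boldsymbol x_t+b_t$ ($t=1,\dots,n$), where $e_t,b_t\sim\mathcal N_{\mathbb C}(0,1)$ and the channel vectors $\boldsymbol h_t,\boldsymbol g_t\in\mathbb C^M$ all have one common law $\nu$ with $\mathbb E\log(1+\|\boldsymbol h_t\|^2)<\infty$, and where all the noises and channel vectors, at all times, are mutually independent. A code of length $n$ has independent messages $W_1,W_2$, uniform on finite sets of sizes $M_{1,n},M_{2,n}$ and independent of the channel; a stochastic encoder with delayed CSIT, $\boldsymbol x_t=F_t(W_1,W_2,U,\boldsymbol h_1,\dots,\boldsymbol h_{t-1},\boldsymbol g_1,\dots,\boldsymbol g_{t-1})$, where the random seed $U$ is independent of the messages and of the channel; and decoders $\hat W_1(Y^n,H^n,G^n)$, $\hat W_2(Z^n,H^n,G^n)$. It obeys the power constraint $P$ if $\mathbb E\big[\frac1n\sum_{t=1}^n\|\boldsymbol x_t\|^2\big]\le P$ (in particular if $\frac1n\sum_t\|\boldsymbol x_t\|^2\le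 P$ always). A pair $(d_1,d_2)$ with $d_1,d_2\ge 0$ is achievable if there are codes, one for each $P>0$ and each $n$, that obey the power constraint $P$, satisfy $\Pr\{(\hat W_1,\hat W_2)\ne(W_1,W_2)\}\to0$ as $n\to\infty$ for every $P$, and satisfy $$\liminf_{P\to\infty}\liminf_{n\to\infty}\frac{n^{-1}\log_2 M_{i,n}(P)}{\log_2P}\ge d_i\quad(i=1,2),$$ $$\lim_{P\to\infty}\limsup_{n\to\infty}\frac{n^{-1}I(W_1;Z^n,H^n,G^n)}{\log_2P}=0,\qquad \lim_{P\to\infty}\limsup_{n\to\infty}\frac{n^{-1}I(W_2;Y^n,H^n,G^n)}{\log_2P}=0 .$$ The SDoF region is the closure of the set of achievable pairs. Theorem. The SDoF region is contained in $$\mathcal R_{\mathrm{BCC}}=\{(d_1,d_2)\in\mathbb R^2:\ d_1,d_2\ge0,\ 3d_1+d_2\le2,\ d_1+3d_2\le2\}.$$ -/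

import Mathlib

open MeasureTheory ProbabilityTheory Filter Topology
open scoped ENNReal NNReal

namespace MISOBCC

noncomputable section

/-- Vectors in `ℂ^M` (channel vectors and channel inputs of a transmitter with `M` antennas). -/
abbrev CVec (M : ℕ) : Type := Fin M → ℂ

/-- The circularly symmetric complex Gaussian law `N_ℂ(0,1)`: independent real and imaginary
parts, each `N(0,1/2)`. -/
def complexGaussian : Measure ℂ :=
  ((gaussianReal 0 (1 / 2)).prod (gaussianReal 0 (1 / 2))).map
    (fun p : ℝ × ℝ => (⟨p.1, p.2⟩ : ℂ))

/-- Mutual information `I(X;Y)` in bits of two random variables on `(Ω, μ)`: the relative entropy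
of the joint law with respect to the product of the marginal laws. -/
def mutualInfo {Ω α β : Type*} [MeasurableSpace Ω] [MeasurableSpace α] [MeasurableSpace β]
    (μ : Measure Ω) (X : Ω → α) (Y : Ω → β) : ℝ≥0∞ :=
  InformationTheory.klDiv (μ.map (fun ω => (X ω, Y ω))) ((μ.map X).prod (μ.map Y))
    / ENNReal.ofReal (Real.log 2)

/-- A code of block length `n` for the two-user broadcast channel with `M` transmit antennas and
delayed channel state information of both receivers at the transmitter. The stochastic encoder
is a sequence of functions of the two messages, of a random seed (an arbitrary probability space,
shared by all channel uses and unknown to the receivers) and of the strictly past channel vectors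
of the two receivers. Each decoder sees the outputs of its receiver and the channel vectors. -/
structure Code (M n : ℕ) where
  /-- number of messages for receiver 1 -/
  m₁ : ℕ
  /-- number of messages for receiver 2 -/
  m₂ : ℕ
  m₁_pos : 0 < m₁
  m₂_pos : 0 < m₂
  /-- space of the private random seed of the encoder -/
  Seed : Type
  measurableSpaceSeed : MeasurableSpace Seed
  /-- law of the seed -/
  seedLaw : Measure Seed
  isProbabilityMeasure_seedLaw : IsProbabilityMeasure seedLaw
  /-- the encoder at time `t`: it sees `(w₁, w₂, seed, (h_s)_{s<t}, (g_s)_{s<t})` -/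
  enc : (t : Fin n) →
    Fin m₁ × Fin m₂ × Seed × (Fin (t : ℕ) → CVec M) × (Fin (t : ℕ) → CVec M) → CVec M
  measurable_enc : ∀ t, Measurable (enc t)
  /-- decoder of receiver 1, a function of `(y^n, h^n, g^n)` -/
  dec₁ : (Fin n → ℂ) × (Fin n → CVec M) × (Fin n → CVec M) → Fin m₁
  measurable_dec₁ : Measurable dec₁
  /-- decoder of receiver 2, a function of `(z^n, h^n, g^n)` -/
  dec₂ : (Fin n → ℂ) × (Fin n → CVec M) × (Fin n → CVec M) → Fin m₂
  measurable_dec₂ : Measurable dec₂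

attribute [instance] Code.measurableSpaceSeed Code.isProbabilityMeasure_seedLaw

namespace Code

variable {M n : ℕ} (C : Code M n)

/-- The sample space: messages `(w₁, w₂)`, seed, channel vectors `(h^n, g^n)`,
noises `(e^n, b^n)`. -/
abbrev Sample : Type :=
  (Fin C.m₁ × Fin C.m₂) × C.Seed × ((Fin n → CVec M) × (Fin n → CVec M)) ×
    ((Fin n → ℂ) × (Fin n → ℂ))

/-- The joint law: all primitive random variables are independent, the messages are uniform, the
channel vectors `h_t`, `g_t` all have law `ν`, the noises are `N_ℂ(0,1)`. -/
def law (ν : Measure (CVec M)) : Measure C.Sample :=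
  ((uniformOn (Set.univ : Set (Fin C.m₁))).prod (uniformOn (Set.univ : Set (Fin C.m₂)))).prod
    (C.seedLaw.prod
      (((Measure.pi fun _ : Fin n => ν).prod (Measure.pi fun _ : Fin n => ν)).prod
        ((Measure.pi fun _ : Fin n => complexGaussian).prod
          (Measure.pi fun _ : Fin n => complexGaussian))))

/-- message for receiver 1 -/
def W₁ (ω : C.Sample) : Fin C.m₁ := ω.1.1

/-- message for receiver 2 -/
def W₂ (ω : C.Sample) : Fin C.m₂ := ω.1.2

/-- channel vectors of receiver 1 -/
def H (ω : C.Sample) : Fin n → CVec M := ω.2.2.1.1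

/-- channel vectors of receiver 2 -/
def G (ω : C.Sample) : Fin n → CVec M := ω.2.2.1.2

/-- noise at receiver 1 -/
def E (ω : C.Sample) : Fin n → ℂ := ω.2.2.2.1

/-- noise at receiver 2 -/
def B (ω : C.Sample) : Fin n → ℂ := ω.2.2.2.2

/-- channel input `x_t = F_t(w₁, w₂, seed, h^{t-1}, g^{t-1})` -/
def X (ω : C.Sample) (t : Fin n) : CVec M :=
  C.enc t (C.W₁ ω, C.W₂ ω, ω.2.1,
    fun s => C.H ω (Fin.castLE t.isLt.le s), fun s => C.G ω (Fin.castLE t.isLt.le s))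

/-- output at receiver 1: `y_t = h_tᵀ x_t + e_t` -/
def Y (ω : C.Sample) (t : Fin n) : ℂ := C.H ω t ⬝ᵥ C.X ω t + C.E ω t

/-- output at receiver 2: `z_t = g_tᵀ x_t + b_t` -/
def Z (ω : C.Sample) (t : Fin n) : ℂ := C.G ω t ⬝ᵥ C.X ω t + C.B ω t

/-- The average power constraint `E[(1/n) ∑_t tr(x_t x_tᴴ)] ≤ P`, multiplied by `n`. -/
def PowerConstraint (ν : Measure (CVec M)) (P : ℝ) : Prop :=
  ∫⁻ ω, ∑ t, ∑ i, ‖C.X ω t i‖ₑ ^ 2 ∂(C.law ν) ≤ n * ENNReal.ofReal P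

/-- probability that at least one of the two messages is decoded incorrectly -/
def errorProb (ν : Measure (CVec M)) : ℝ≥0∞ :=
  C.law ν {ω | C.dec₁ (C.Y ω, C.H ω, C.G ω) ≠ C.W₁ ω ∨ C.dec₂ (C.Z ω, C.H ω, C.G ω) ≠ C.W₂ ω}

/-- leakage `I(W₁; Z^n, H^n, G^n)` of the first message to receiver 2, in bits -/
def leakage₁ (ν : Measure (CVec M)) : ℝ≥0∞ :=
  mutualInfo (C.law ν) C.W₁ (fun ω => (C.Z ω, C.H ω, C.G ω))

/-- leakage `I(W₂; Y^n, H^n, G^n)` of the second message to receiver 1, in bits -/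
def leakage₂ (ν : Measure (CVec M)) : ℝ≥0∞ :=
  mutualInfo (C.law ν) C.W₂ (fun ω => (C.Y ω, C.H ω, C.G ω))

end Code

/-- `(d₁, d₂)` is an achievable pair of secrecy degrees of freedom: there are codes, one for each
power `P` and block length `n`, that obey the power constraint, whose error probability tends to
`0` as `n → ∞`, whose rates satisfy `lim_P liminf_n n⁻¹ log₂ m_i / log₂ P ≥ d_i`, and whose leakages
satisfy `lim_P limsup_n n⁻¹ I / log₂ P = 0`. -/
def Achievable (M : ℕ) (ν : Measure (CVec M)) (d₁ d₂ : ℝ) : Prop :=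
  0 ≤ d₁ ∧ 0 ≤ d₂ ∧
  ∃ C : (P : ℝ) → (n : ℕ) → Code M n,
    (∀ P, 0 < P → ∀ n, (C P n).PowerConstraint ν P) ∧
    (∀ P, 0 < P → Tendsto (fun n => (C P n).errorProb ν) atTop (𝓝 0)) ∧
    (d₁ : EReal) ≤ liminf (fun P : ℝ => liminf (fun n : ℕ =>
      ((Real.logb 2 (C P n).m₁ / n / Real.logb 2 P : ℝ) : EReal)) atTop) atTop ∧
    (d₂ : EReal) ≤ liminf (fun P : ℝ => liminf (fun n : ℕ =>
      ((Real.logb 2 (C P n).m₂ / n / Real.logb 2 P : ℝ) : EReal)) atTop) atTop ∧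
    Tendsto (fun P : ℝ => limsup (fun n : ℕ =>
      (C P n).leakage₁ ν / n / ENNReal.ofReal (Real.logb 2 P)) atTop) atTop (𝓝 0) ∧
    Tendsto (fun P : ℝ => limsup (fun n : ℕ =>
      (C P n).leakage₂ ν / n / ENNReal.ofReal (Real.logb 2 P)) atTop) atTop (𝓝 0)

/-- The secrecy degrees of freedom region: the closure of the set of achievable pairs. -/
def sdofRegion (M : ℕ) (ν : Measure (CVec M)) : Set (ℝ × ℝ) :=
  closure {d : ℝ × ℝ | Achievable M ν d.1 d.2}

end

end MISOBCC

namespace MISOBCC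

open InformationTheory

/-! ### Relative entropy: chain rule, data processing, Fano's inequality. -/

section KullbackLeibler

variable {α β Ω 𝓕 𝓖 𝓥 𝓦 : Type*} [MeasurableSpace α] [MeasurableSpace β] [MeasurableSpace Ω]
  [MeasurableSpace 𝓕] [MeasurableSpace 𝓖] [MeasurableSpace 𝓥] [MeasurableSpace 𝓦]

/-! Differential entropies are replaced by relative entropies to a fixed product law. Each output is
scaled by `gain`, a positive function of the power and of the fading vector, so a receiver can undo
the scaling. The reference law is N_ℂ(0,1) for scaled outputs and ν for fading vectors. Then
`condDiv μ F V q` acts as a constant minus h(V | F): it is nonnegative, obeys a chain rule in V, and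
increases when F is refined. No entropy has to be finite for this. Under the power constraint the
scaled outputs of one user cost at most N = n (log P + O(1)) in total (`sum_stepCost_le`).

Two facts about the channel are needed. Since the input sees only past fading, exchanging the fading
and noise of the two users at the current time changes neither the past nor the input. Their current
outputs therefore have the same law given the past, and D(joint view | F) ≥ 2 D(own view | F)
(`two_mul_condDiv_ownView_le`). Conversely, adding the other user's outputs to a view costs at most
N (`condDiv_jointView_le`).

Let user b, with view V, decode A (m values), and let the other user, with view V', decode B (m'
values) and learn at most l about A. Let J be the joint view. As messages are independent and
uniform, D(V | A) − D(V) = I(A; V), and similarly with further conditioning. Up to Fano terms, 2 log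
m ≤ 2 D(V | A) ≤ D(V' | A) + N, 2 D(V' | B) + log m ≤ D(J | B) + I(A; B, J) = D(J | A, B) ≤ D(V' |
A, B) + N, D(V') + log m' ≤ D(V' | B), D(V' | A) ≤ D(V') + l, D(V' | A, B) ≤ D(V' | A) + log m'. On
adding these D(V') cancels, leaving 3 log m + log m' ≤ 2N + 2l (`finite_blocklength_converse`).
Dividing by n log P and passing to the limit gives one inequality (`dof_bound_of_rate_bound`);
exchanging the users gives the other. -/

theorem klDiv_map_equiv (μ ν : Measure α) [IsFiniteMeasure μ] [IsFiniteMeasure ν] (e : α ≃ᵐ β) :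
    klDiv (μ.map e) (ν.map e) = klDiv μ ν := by
  refine le_antisymm (klDiv_map_le μ ν e.measurable) ?_
  have h := klDiv_map_le (μ.map e) (ν.map e) e.symm.measurable
  rwa [Measure.map_map e.symm.measurable e.measurable, Measure.map_map e.symm.measurable
    e.measurable, e.symm_comp_self, Measure.map_id, Measure.map_id] at h

/-- Disintegrate ρ over its first marginal and apply the chain rule against the constant kernel q;
the standard Borel assumption provides the conditional kernel. -/
theorem klDiv_prod_right_eq_add [StandardBorelSpace β] [Nonempty β] (ρ : Measure (α × β))
    [IsFiniteMeasure ρ] (p : Measure α) (q : Measure β) [IsFiniteMeasure p]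
    [IsProbabilityMeasure q] :
    klDiv ρ (p.prod q) = klDiv ρ.fst p + klDiv ρ (ρ.fst.prod q) := by
  have h := klDiv_compProd_eq_add ρ.fst p ρ.condKernel (Kernel.const α q)
  rwa [Measure.disintegrate, Measure.compProd_const, Measure.compProd_const] at h

/-- Legendre duality for `klFun`. -/
theorem mul_sub_exp_le_klFun {x : ℝ} (hx : 0 ≤ x) (y : ℝ) :
    x * y - Real.exp y + 1 ≤ klFun x := by
  rw [klFun_apply]
  rcases hx.eq_or_lt with rfl | hx
  · simp [Real.exp_nonneg]
  · have h := Real.add_one_le_exp (y - Real.log x)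
    rw [Real.exp_sub, Real.exp_log hx, le_div_iff₀ hx] at h
    nlinarith

/-- A form of Fano's inequality: an event which is rare under `Q` is charged by `P` only at the
expense of a large divergence. -/
theorem mul_log_sub_log_two_le_klDiv (P Q : Measure α) [IsProbabilityMeasure P]
    [IsProbabilityMeasure Q] {A : Set α} (hA : MeasurableSet A) {m : ℝ} (hm : 1 ≤ m)
    (hQ : Q.real A ≤ m⁻¹) :
    ENNReal.ofReal (P.real A * Real.log m - Real.log 2) ≤ klDiv P Q := by
  by_cases htop : klDiv P Q = ∞
  · simp [htop]
  obtain ⟨hac, hint⟩ := klDiv_ne_top_iff.1 htop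
  refine ENNReal.ofReal_le_of_le_toReal ?_
  rw [toReal_klDiv_eq_integral_klFun hac]
  have hm0 : 0 < m := by linarith
  -- Test function for the duality: exp f is m/2 on A and 1/2 off A, so its Q-mean is at most 1 as
  -- soon as Q(A) ≤ 1/m. Integrating `mul_sub_exp_le_klFun` then bounds the P-mean of f by the
  -- divergence.
  let f : α → ℝ := fun x => A.indicator (fun _ => Real.log m) x - Real.log 2
  have hfm : Measurable f := by
    exact ((measurable_const.indicator hA).sub measurable_const)
  have hexp : ∀ x, Real.exp (f x) = A.indicator (fun _ => (m - 1) / 2) x + 1 / 2 := by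
    intro x
    simp only [f]
    by_cases hx : x ∈ A
    · simp only [Set.indicator_of_mem hx, Real.exp_sub, Real.exp_log hm0,
        Real.exp_log (zero_lt_two' ℝ)]; ring
    · simp [Set.indicator_of_notMem hx, Real.exp_neg, Real.exp_log (zero_lt_two' ℝ)]
  have hbd : ∀ x, ‖f x‖ ≤ Real.log m + Real.log 2 := by
    intro x
    have h1 := Real.log_nonneg hm
    have h2 := Real.log_nonneg one_le_two
    simp only [f, Real.norm_eq_abs]
    by_cases hx : x ∈ A
    · rw [Set.indicator_of_mem hx, abs_le]; constructor <;> linarith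
    · rw [Set.indicator_of_notMem hx, abs_le]; constructor <;> linarith
  have hfP : Integrable f P := Integrable.of_bound hfm.aestronglyMeasurable _ (ae_of_all _ hbd)
  have hi1 : Integrable (fun x => (P.rnDeriv Q x).toReal * f x) Q :=
    (integrable_toReal_rnDeriv_mul_iff hac).2 hfP
  have hi2 : Integrable (fun x => Real.exp (f x)) Q := by
    simp only [hexp]
    exact ((integrable_const _).indicator hA).add (integrable_const _)
  have hi3 : Integrable (fun x => klFun (P.rnDeriv Q x).toReal) Q :=
    (integrable_klFun_rnDeriv_iff hac).2 hint
  have hmono : ∫ x, ((P.rnDeriv Q x).toReal * f x - Real.exp (f x) + 1) ∂Q ≤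
      ∫ x, klFun (P.rnDeriv Q x).toReal ∂Q :=
    integral_mono ((hi1.sub hi2).add (integrable_const 1)) hi3
      fun x => mul_sub_exp_le_klFun ENNReal.toReal_nonneg _
  refine le_trans ?_ hmono
  have e1 : ∫ x, (P.rnDeriv Q x).toReal * f x ∂Q = P.real A * Real.log m - Real.log 2 := by
    have := integral_rnDeriv_smul (f := f) hac
    simp only [smul_eq_mul] at this
    rw [this, integral_sub ((integrable_const _).indicator hA) (integrable_const _),
      integral_indicator_const _ hA]
    simp
  have e2 : ∫ x, Real.exp (f x) ∂Q = Q.real A * ((m - 1) / 2) + 1 / 2 := by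
    simp only [hexp]
    rw [integral_add ((integrable_const _).indicator hA) (integrable_const _),
      integral_indicator_const _ hA]
    simp
  have hi12 : Integrable (fun x => (P.rnDeriv Q x).toReal * f x - Real.exp (f x)) Q := hi1.sub hi2
  rw [integral_add hi12 (integrable_const 1), integral_sub hi1 hi2, e1, e2]
  have h3 : Q.real A * ((m - 1) / 2) ≤ m⁻¹ * ((m - 1) / 2) :=
    mul_le_mul_of_nonneg_right hQ (by linarith)
  have h4 : m⁻¹ * ((m - 1) / 2) ≤ 1 / 2 := by
    have : m⁻¹ * ((m - 1) / 2) = 1 / 2 - m⁻¹ / 2 := by field_simp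
    rw [this]
    have := inv_pos.2 hm0
    linarith
  simp only [integral_const, probReal_univ, smul_eq_mul, mul_one]
  linarith

/-- A measure dominated by `c • Q` has divergence at most `log c` from `Q`. -/
theorem klDiv_le_log_of_le_smul (P Q : Measure α) [IsProbabilityMeasure P]
    [IsProbabilityMeasure Q] {c : ℝ≥0} (h : P ≤ c • Q) :
    klDiv P Q ≤ ENNReal.ofReal (Real.log c) := by
  have hac : P ≪ Q := by
    refine (Measure.absolutelyContinuous_of_le h).trans ?_
    exact Measure.smul_absolutelyContinuous
  rw [klDiv_eq_lintegral_klFun_of_ac hac]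
  -- With the density r at most c, r log r ≤ r log c pointwise, and r has Q-mean 1.
  have hr : ∀ᵐ x ∂Q, P.rnDeriv Q x ≤ c := by
    refine ae_le_of_forall_setLIntegral_le_of_sigmaFinite (Measure.measurable_rnDeriv P Q)
      (fun s hs _ => ?_)
    calc ∫⁻ x in s, P.rnDeriv Q x ∂Q ≤ P s := Measure.setLIntegral_rnDeriv_le s
      _ ≤ (c • Q) s := h s
      _ = ∫⁻ _ in s, (c : ℝ≥0∞) ∂Q := by
        rw [Measure.smul_apply, setLIntegral_const, ENNReal.smul_def, smul_eq_mul]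
  have hi : Integrable (fun x => (P.rnDeriv Q x).toReal) Q := Measure.integrable_toReal_rnDeriv
  have hle : ∀ᵐ x ∂Q, klFun (P.rnDeriv Q x).toReal ≤
      (P.rnDeriv Q x).toReal * Real.log c + 1 - (P.rnDeriv Q x).toReal := by
    filter_upwards [hr] with x hx
    have hx' : (P.rnDeriv Q x).toReal ≤ c := by
      simpa using ENNReal.toReal_mono ENNReal.coe_ne_top hx
    rw [klFun_apply]
    rcases (ENNReal.toReal_nonneg : 0 ≤ (P.rnDeriv Q x).toReal).eq_or_lt with h0 | h0
    · simp [← h0]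
    · have := mul_le_mul_of_nonneg_left (Real.log_le_log h0 hx') h0.le
      linarith
  calc ∫⁻ x, ENNReal.ofReal (klFun (P.rnDeriv Q x).toReal) ∂Q
      ≤ ∫⁻ x, ENNReal.ofReal ((P.rnDeriv Q x).toReal * Real.log c + 1
          - (P.rnDeriv Q x).toReal) ∂Q := by
        refine lintegral_mono_ae ?_
        filter_upwards [hle] with x hx using ENNReal.ofReal_le_ofReal hx
    _ = ENNReal.ofReal (∫ x, ((P.rnDeriv Q x).toReal * Real.log c + 1
          - (P.rnDeriv Q x).toReal) ∂Q) := by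
        refine (ofReal_integral_eq_lintegral_ofReal
          (((hi.mul_const _).add (integrable_const _)).sub hi) ?_).symm
        filter_upwards [hle] with x hx
        exact (klFun_nonneg ENNReal.toReal_nonneg).trans hx
    _ = ENNReal.ofReal (Real.log c) := by
        have hi' : Integrable (fun x => (P.rnDeriv Q x).toReal * Real.log c + 1) Q :=
          (hi.mul_const _).add (integrable_const _)
        rw [integral_sub hi' hi, integral_add (hi.mul_const _)
          (integrable_const _), integral_mul_const, Measure.integral_toReal_rnDeriv hac]
        simp

/-- The divergence of the conditional law of `V` given `F` from the fixed law `q`. -/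
noncomputable def condDiv (μ : Measure Ω) (F : Ω → 𝓕) (V : Ω → 𝓥) (q : Measure 𝓥) : ℝ≥0∞ :=
  klDiv (μ.map fun ω => (F ω, V ω)) ((μ.map F).prod q)

variable {μ : Measure Ω} {F : Ω → 𝓕} {V : Ω → 𝓥} {q : Measure 𝓥}

theorem condDiv_congr {V' : Ω → 𝓥}
    (h : (μ.map fun ω => (F ω, V ω)) = μ.map fun ω => (F ω, V' ω)) :
    condDiv μ F V q = condDiv μ F V' q := by
  rw [condDiv, h, condDiv]

variable [IsProbabilityMeasure μ]

theorem condDiv_prod [StandardBorelSpace 𝓦] [Nonempty 𝓦] (hF : Measurable F) (hV : Measurable V)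
    {W : Ω → 𝓦} (hW : Measurable W) [IsProbabilityMeasure q] (r : Measure 𝓦)
    [IsProbabilityMeasure r] :
    condDiv μ F (fun ω => (V ω, W ω)) (q.prod r) =
      condDiv μ F V q + condDiv μ (fun ω => (F ω, V ω)) W r := by
  have : IsProbabilityMeasure (μ.map F) := Measure.isProbabilityMeasure_map hF.aemeasurable
  have hm : Measurable fun ω => ((F ω, V ω), W ω) := (hF.prodMk hV).prodMk hW
  have : IsProbabilityMeasure (μ.map fun ω => ((F ω, V ω), W ω)) :=
    Measure.isProbabilityMeasure_map hm.aemeasurable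
  have h := klDiv_prod_right_eq_add (μ.map fun ω => ((F ω, V ω), W ω)) ((μ.map F).prod q) r
  rw [Measure.fst_map_prodMk (X := fun ω => (F ω, V ω)) hW,
    ← klDiv_map_equiv _ (((μ.map F).prod q).prod r) MeasurableEquiv.prodAssoc,
    Measure.map_map MeasurableEquiv.prodAssoc.measurable hm,
    (measurePreserving_prodAssoc (μ.map F) q r).map_eq] at h
  exact h

/-- Data processing in the conditioning variable. -/
theorem condDiv_comp_left_le (hF : Measurable F) (hV : Measurable V) [IsProbabilityMeasure q]
    {φ : 𝓕 → 𝓖} (hφ : Measurable φ) :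
    condDiv μ (fun ω => φ (F ω)) V q ≤ condDiv μ F V q := by
  have : IsProbabilityMeasure (μ.map F) := Measure.isProbabilityMeasure_map hF.aemeasurable
  have h := klDiv_map_le (μ.map fun ω => (F ω, V ω)) ((μ.map F).prod q)
    (g := Prod.map φ id) (hφ.prodMap measurable_id)
  rw [Measure.map_map (hφ.prodMap measurable_id) (hF.prodMk hV), ← Measure.map_prod_map _ _ hφ
    measurable_id, Measure.map_id, Measure.map_map hφ hF] at h
  exact h

/-- Data processing in the conditioned variable. -/
theorem condDiv_comp_right_le (hF : Measurable F) (hV : Measurable V) [IsProbabilityMeasure q]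
    {r : Measure 𝓦} {ψ : 𝓥 → 𝓦} (hψ : MeasurePreserving ψ q r) :
    condDiv μ F (fun ω => ψ (V ω)) r ≤ condDiv μ F V q := by
  have : IsProbabilityMeasure (μ.map F) := Measure.isProbabilityMeasure_map hF.aemeasurable
  have h := klDiv_map_le (μ.map fun ω => (F ω, V ω)) ((μ.map F).prod q)
    (g := Prod.map id ψ) (measurable_id.prodMap hψ.measurable)
  rw [Measure.map_map (measurable_id.prodMap hψ.measurable) (hF.prodMk hV),
    ← Measure.map_prod_map _ _ measurable_id hψ.measurable, Measure.map_id, hψ.map_eq] at h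
  exact h

theorem condDiv_comp_equiv (hF : Measurable F) (hV : Measurable V) [IsProbabilityMeasure q]
    {r : Measure 𝓦} (e : 𝓥 ≃ᵐ 𝓦) (he : MeasurePreserving e q r) :
    condDiv μ F (fun ω => e (V ω)) r = condDiv μ F V q := by
  have : IsProbabilityMeasure r := by
    rw [← he.map_eq]; exact Measure.isProbabilityMeasure_map e.measurable.aemeasurable
  refine le_antisymm (condDiv_comp_right_le hF hV he) ?_
  simpa [Function.comp_def] using
    condDiv_comp_right_le hF (e.measurable.comp hV) (MeasurePreserving.symm e he)

theorem condDiv_eq_zero [IsProbabilityMeasure q]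
    (h : (μ.map fun ω => (F ω, V ω)) = (μ.map F).prod q) : condDiv μ F V q = 0 := by
  rw [condDiv, h, klDiv_self]

/-- Exchanging the roles of an independent component of the conditioning variable and of the
conditioned variable. -/
theorem condDiv_prod_left [StandardBorelSpace 𝓥] [Nonempty 𝓥] [StandardBorelSpace 𝓦] [Nonempty 𝓦]
    (hF : Measurable F) (hV : Measurable V) {W : Ω → 𝓦} (hW : Measurable W)
    [IsProbabilityMeasure q] (r : Measure 𝓦) [IsProbabilityMeasure r]
    (hind : (μ.map fun ω => (F ω, W ω)) = (μ.map F).prod r) :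
    condDiv μ (fun ω => (F ω, W ω)) V q =
      condDiv μ F V q + condDiv μ (fun ω => (F ω, V ω)) W r := by
  -- Expand the divergence of the pair (V, W) given F in both orders; with W first, its own term
  -- vanishes by independence.
  have h := condDiv_prod (μ := μ) (q := q) hF hV hW r
  rw [← h,
    ← condDiv_comp_equiv hF (hV.prodMk hW) (q := q.prod r) MeasurableEquiv.prodComm
    (Measure.measurePreserving_swap (μ := q) (ν := r))]
  have := condDiv_prod (μ := μ) (q := r) hF hW hV q
  rw [condDiv_eq_zero hind, zero_add] at this
  exact this.symm

/-- Divergence between the joint law of `(F, W)` and the product of the marginals, for `W` with a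
uniform law on `m` points, is at most `log m`. -/
theorem condDiv_uniformOn_le {m : ℕ} [NeZero m] (hF : Measurable F) {W : Ω → Fin m}
    (hW : Measurable W) :
    condDiv μ F W (uniformOn Set.univ) ≤ ENNReal.ofReal (Real.log m) := by
  have : IsProbabilityMeasure (μ.map F) := Measure.isProbabilityMeasure_map hF.aemeasurable
  have : IsProbabilityMeasure (μ.map fun ω => (F ω, W ω)) :=
    Measure.isProbabilityMeasure_map (hF.prodMk hW).aemeasurable
  have : IsProbabilityMeasure (uniformOn (Set.univ : Set (Fin m))) :=
    isProbabilityMeasure_uniformOn Set.finite_univ Set.univ_nonempty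
  refine klDiv_le_log_of_le_smul _ _ (c := m) (Measure.le_iff.2 fun s hs => ?_)
  rw [Measure.map_apply (hF.prodMk hW) hs, Measure.smul_apply, Measure.prod_apply hs,
    lintegral_map (measurable_measure_prodMk_left hs) hF, ENNReal.smul_def, smul_eq_mul,
    ← lintegral_const_mul _ (show Measurable fun ω => uniformOn Set.univ (Prod.mk (F ω) ⁻¹' s) from
      (measurable_measure_prodMk_left hs).comp hF),
    ← lintegral_indicator_one (hs.preimage (hF.prodMk hW))]
  refine lintegral_mono fun ω => ?_
  by_cases hω : (F ω, W ω) ∈ s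
  · rw [Set.indicator_of_mem (by exact hω)]
    -- The joint law is at most m times the product law: a fibre containing the point `W ω` has
    -- uniform mass at least 1/m.
    have h1 : (uniformOn (Set.univ : Set (Fin m))) {W ω} ≤
        (uniformOn (Set.univ : Set (Fin m))) (Prod.mk (F ω) ⁻¹' s) :=
      measure_mono (by simpa using hω)
    refine le_trans ?_ (mul_le_mul_right h1 _)
    rw [uniformOn_univ]
    have hm : (m : ℝ≥0∞) ≠ 0 := by exact_mod_cast NeZero.ne m
    simp [ENNReal.mul_inv_cancel hm]
  · rw [Set.indicator_of_notMem (by exact hω)]; exact zero_le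

/-- Fano's inequality for a uniform message and a decoder. -/
theorem fano_le_condDiv {m : ℕ} [NeZero m] (hF : Measurable F) {W : Ω → Fin m}
    (hW : Measurable W) {d : 𝓕 → Fin m} (hd : Measurable d) {ε : ℝ}
    (hε : μ.real {ω | d (F ω) ≠ W ω} ≤ ε) :
    ENNReal.ofReal ((1 - ε) * Real.log m - Real.log 2) ≤
      condDiv μ F W (uniformOn Set.univ) := by
  have : IsProbabilityMeasure (μ.map F) := Measure.isProbabilityMeasure_map hF.aemeasurable
  have : IsProbabilityMeasure (μ.map fun ω => (F ω, W ω)) :=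
    Measure.isProbabilityMeasure_map (hF.prodMk hW).aemeasurable
  have : IsProbabilityMeasure (uniformOn (Set.univ : Set (Fin m))) :=
    isProbabilityMeasure_uniformOn Set.finite_univ Set.univ_nonempty
  have hA : MeasurableSet {p : 𝓕 × Fin m | d p.1 = p.2} :=
    measurableSet_eq_fun (hd.comp measurable_fst) measurable_snd
  have hm1 : (1 : ℝ) ≤ m := by exact_mod_cast NeZero.one_le
  refine le_trans (ENNReal.ofReal_le_ofReal ?_)
    (mul_log_sub_log_two_le_klDiv (μ.map fun ω => (F ω, W ω))
      ((μ.map F).prod (uniformOn Set.univ)) hA hm1 ?_)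
  · refine sub_le_sub_right (mul_le_mul_of_nonneg_right ?_ (Real.log_nonneg hm1)) _
    rw [map_measureReal_apply (hF.prodMk hW) hA]
    have hc : (fun ω => (F ω, W ω)) ⁻¹' {p : 𝓕 × Fin m | d p.1 = p.2} =
        {ω | d (F ω) ≠ W ω}ᶜ := by ext; simp
    have hB : MeasurableSet {ω | d (F ω) ≠ W ω} := (measurableSet_eq_fun (hd.comp hF) hW).compl
    rw [hc, probReal_compl_eq_one_sub hB]
    linarith
  · rw [measureReal_def, Measure.prod_apply hA]
    -- Under the product law W is uniform and independent of the guess, which is right with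
    -- probability exactly 1/m.
    have : ∀ x, (uniformOn (Set.univ : Set (Fin m))) (Prod.mk x ⁻¹' {p : 𝓕 × Fin m | d p.1 = p.2})
        = (m : ℝ≥0∞)⁻¹ := by
      intro x
      have : Prod.mk x ⁻¹' {p : 𝓕 × Fin m | d p.1 = p.2} = {d x} := by ext; simp [eq_comm]
      rw [this, uniformOn_univ]; simp
    rw [lintegral_congr this]; simp

end KullbackLeibler

/-! ### Divergence of an affine image of a Gaussian from the Gaussian. -/

section Gaussian

variable {ρ Ω : Type*} [MeasurableSpace ρ] [MeasurableSpace Ω]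

instance : IsProbabilityMeasure complexGaussian := by
  have : Measurable fun p : ℝ × ℝ => (⟨p.1, p.2⟩ : ℂ) :=
    Complex.measurableEquivRealProd.symm.measurable
  exact Measure.isProbabilityMeasure_map this.aemeasurable

/-- Log-likelihood ratio at `y` of `N(m, c²/2)` with respect to `N(0, 1/2)`. -/
noncomputable def gaussianLogRatio (m c y : ℝ) : ℝ :=
  -Real.log c + y ^ 2 - (y - m) ^ 2 / c ^ 2

theorem gaussianReal_map_affine (m : ℝ) {c : ℝ} (hc : 0 < c) :
    (gaussianReal 0 (1 / 2)).map (fun y => m + c * y) =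
      (gaussianReal 0 (1 / 2)).withDensity
        (fun y => ENNReal.ofReal (Real.exp (gaussianLogRatio m c y))) := by
  have h1 : (gaussianReal 0 (1 / 2)).map (fun y => m + c * y) =
      gaussianReal m (⟨c ^ 2, sq_nonneg c⟩ * (1 / 2)) := by
    have : (fun y => m + c * y) = (fun z => m + z) ∘ fun y => c * y := rfl
    rw [this, ← Measure.map_map (by fun_prop) (by fun_prop), gaussianReal_map_const_mul,
      gaussianReal_map_const_add]
    simp
    rfl
  have hv : (⟨c ^ 2, sq_nonneg c⟩ * (1 / 2) : ℝ≥0) ≠ 0 := by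
    refine mul_ne_zero (fun h => (pow_pos hc 2).ne' ?_) (by norm_num)
    exact congrArg NNReal.toReal h
  have hg : Measurable fun y => ENNReal.ofReal (Real.exp (gaussianLogRatio m c y)) := by
    unfold gaussianLogRatio; fun_prop
  rw [h1, gaussianReal_of_var_ne_zero _ hv, gaussianReal_of_var_ne_zero _ (by norm_num),
    ← withDensity_mul _ (measurable_gaussianPDF _ _) hg]
  congr 1
  ext y
  rw [Pi.mul_apply, gaussianPDF, gaussianPDF, ← ENNReal.ofReal_mul (gaussianPDFReal_nonneg _ _ _)]
  congr 1
  simp only [gaussianPDFReal, gaussianLogRatio]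
  have h2 : (((⟨c ^ 2, sq_nonneg c⟩ * (1 / 2) : ℝ≥0)) : ℝ) = c ^ 2 * (1 / 2) := by
    rfl
  have h3 : (((1 / 2 : ℝ≥0)) : ℝ) = 1 / 2 := by push_cast; rfl
  rw [h2, h3, mul_assoc _ (Real.exp _) (Real.exp _), ← Real.exp_add]
  have h4 : √(2 * Real.pi * (c ^ 2 * (1 / 2))) = c * √Real.pi := by
    rw [show 2 * Real.pi * (c ^ 2 * (1 / 2)) = c ^ 2 * Real.pi by ring,
      Real.sqrt_mul (sq_nonneg c), Real.sqrt_sq hc.le]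
  have h5 : √(2 * Real.pi * (1 / 2)) = √Real.pi := by
    rw [show 2 * Real.pi * (1 / 2) = Real.pi by ring]
  rw [h4, h5, mul_inv_rev, mul_assoc]
  congr 1
  have h6 : -(y - 0) ^ 2 / (2 * (1 / 2)) + (-Real.log c + y ^ 2 - (y - m) ^ 2 / c ^ 2) =
      -Real.log c + -(y - m) ^ 2 / (2 * (c ^ 2 * (1 / 2))) := by
    have h7 : -(y - 0) ^ 2 / (2 * (1 / 2)) = - y ^ 2 := by norm_num
    have h8 : 2 * (c ^ 2 * (1 / 2)) = c ^ 2 := by ring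
    rw [h7, h8, neg_div]
    abel
  rw [h6, Real.exp_add, Real.exp_neg, Real.exp_log hc]

theorem map_affine_gaussian_eq_withDensity (κ : Measure ρ) [IsProbabilityMeasure κ] {m c : ρ → ℝ}
    (hm : Measurable m) (hc : Measurable c) (hc0 : ∀ r, 0 < c r) :
    ((κ.prod (gaussianReal 0 (1 / 2))).map fun p => (p.1, m p.1 + c p.1 * p.2)) =
      (κ.prod (gaussianReal 0 (1 / 2))).withDensity
        (fun p => ENNReal.ofReal (Real.exp (gaussianLogRatio (m p.1) (c p.1) p.2))) := by
  have hT : Measurable fun p : ρ × ℝ => (p.1, m p.1 + c p.1 * p.2) := by fun_prop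
  have hg : Measurable fun p : ρ × ℝ =>
      ENNReal.ofReal (Real.exp (gaussianLogRatio (m p.1) (c p.1) p.2)) := by
    unfold gaussianLogRatio; fun_prop
  ext s hs
  rw [Measure.map_apply hT hs, withDensity_apply _ hs, Measure.prod_apply (hT hs),
    ← lintegral_indicator hs, lintegral_prod _ (hg.indicator hs).aemeasurable]
  refine lintegral_congr fun r => ?_
  have h := gaussianReal_map_affine (m r) (hc0 r)
  have hs' : MeasurableSet (Prod.mk r ⁻¹' s) := measurable_prodMk_left hs
  have := congrArg (fun ν => ν (Prod.mk r ⁻¹' s)) h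
  rw [Measure.map_apply (by fun_prop) hs', withDensity_apply _ hs',
    ← lintegral_indicator hs'] at this
  exact this

theorem integral_sq_gaussianReal_half : ∫ x, x ^ 2 ∂(gaussianReal 0 (1 / 2)) = 1 / 2 := by
  have h := variance_fun_id_gaussianReal (μ := 0) (v := 1 / 2)
  rw [variance_eq_integral (by fun_prop), integral_id_gaussianReal] at h
  simpa using h

/-- At m + c e the log-likelihood ratio is −log c + m² + 2mce + (c² − 1)e². Averaging over e leaves
−log c + m² + (c² − 1)/2, and the last term is nonpositive because c ≤ 1. -/
theorem klDiv_map_affine_gaussian_le (κ : Measure ρ) [IsProbabilityMeasure κ] {m c : ρ → ℝ}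
    (hm : Measurable m) (hc : Measurable c) (hc0 : ∀ r, 0 < c r) (hc1 : ∀ r, c r ≤ 1) :
    klDiv ((κ.prod (gaussianReal 0 (1 / 2))).map fun p => (p.1, m p.1 + c p.1 * p.2))
      (κ.prod (gaussianReal 0 (1 / 2))) ≤
        ∫⁻ r, ENNReal.ofReal (-Real.log (c r) + m r ^ 2) ∂κ := by
  obtain ⟨γ, hγ⟩ : ∃ γ, γ = gaussianReal 0 (1 / 2) := ⟨_, rfl⟩
  have hγp : IsProbabilityMeasure γ := by rw [hγ]; infer_instance
  rw [← hγ]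
  have hlog : ∀ r, 0 ≤ -Real.log (c r) := fun r => by
    have := Real.log_nonpos (hc0 r).le (hc1 r); linarith
  have hg0 : ∀ r, 0 ≤ -Real.log (c r) + m r ^ 2 := fun r => add_nonneg (hlog r) (sq_nonneg _)
  have hgm : Measurable fun r => -Real.log (c r) + m r ^ 2 := by fun_prop
  -- An infinite bound is trivial; a finite one supplies the integrability of log c and of m².
  by_cases htop : ∫⁻ r, ENNReal.ofReal (-Real.log (c r) + m r ^ 2) ∂κ = ∞
  · rw [htop]; exact le_top
  have hgi : Integrable (fun r => -Real.log (c r) + m r ^ 2) κ :=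
    (lintegral_ofReal_ne_top_iff_integrable hgm.aestronglyMeasurable (ae_of_all _ hg0)).1 htop
  have hli : Integrable (fun r => -Real.log (c r)) κ := by
    refine hgi.mono' hc.log.neg.aestronglyMeasurable (ae_of_all _ fun r => ?_)
    rw [Real.norm_of_nonneg (hlog r)]; nlinarith [sq_nonneg (m r)]
  have hmi : Integrable (fun r => m r ^ 2) κ := by
    refine hgi.mono' (by fun_prop) (ae_of_all _ fun r => ?_)
    rw [Real.norm_of_nonneg (sq_nonneg _)]; linarith [hlog r]
  have hmc : Integrable (fun r => 2 * m r * c r) κ := by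
    refine (hmi.add (integrable_const (1 : ℝ))).mono' (by fun_prop) (ae_of_all _ fun r => ?_)
    simp only [Pi.add_apply, Real.norm_eq_abs, abs_mul, abs_two, abs_of_pos (hc0 r)]
    have h1 := hc0 r
    have h2 := hc1 r
    have h3 := abs_nonneg (m r)
    have h4 := sq_abs (m r)
    nlinarith [sq_nonneg (|m r| - 1)]
  have hcc : Integrable (fun r => c r ^ 2 - 1) κ := by
    refine Integrable.of_bound (by fun_prop) 1 (ae_of_all _ fun r => ?_)
    rw [Real.norm_eq_abs, abs_le]
    have h1 := hc0 r
    have h2 := hc1 r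
    constructor <;> nlinarith
  have he1 : Integrable (fun x : ℝ => x) γ := by
    rw [hγ]; exact (memLp_id_gaussianReal 1).integrable le_rfl
  have he2 : Integrable (fun x : ℝ => x ^ 2) γ := by
    rw [hγ]; exact (memLp_id_gaussianReal 2).integrable_sq
  have hT : Measurable fun p : ρ × ℝ => (p.1, m p.1 + c p.1 * p.2) := by fun_prop
  let f : ρ × ℝ → ℝ := fun p => gaussianLogRatio (m p.1) (c p.1) p.2
  have hfm : Measurable f := by simp only [f]; unfold gaussianLogRatio; fun_prop
  have hP := map_affine_gaussian_eq_withDensity κ hm hc hc0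
  rw [← hγ] at hP
  set P := (κ.prod γ).map fun p => (p.1, m p.1 + c p.1 * p.2) with hPdef
  have : IsProbabilityMeasure P := Measure.isProbabilityMeasure_map hT.aemeasurable
  have hac : P ≪ κ.prod γ := by rw [hP]; exact withDensity_absolutelyContinuous _ _
  have hllr : llr P (κ.prod γ) =ᵐ[P] f := by
    refine hac.ae_le ?_
    have h1 : P.rnDeriv (κ.prod γ) =ᵐ[κ.prod γ] fun p => ENNReal.ofReal (Real.exp (f p)) := by
      rw [hP]; exact Measure.rnDeriv_withDensity _ (hfm.exp.ennreal_ofReal)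
    filter_upwards [h1] with p hp
    rw [llr, hp, ENNReal.toReal_ofReal (Real.exp_nonneg _), Real.log_exp]
  have hfT : ∀ p : ρ × ℝ, f (p.1, m p.1 + c p.1 * p.2) =
      -Real.log (c p.1) + m p.1 ^ 2 + 2 * m p.1 * c p.1 * p.2 + (c p.1 ^ 2 - 1) * p.2 ^ 2 := by
    intro p
    have := (hc0 p.1).ne'
    simp only [f, gaussianLogRatio]
    field_simp
    ring
  have j1 : Integrable (fun p : ρ × ℝ => -Real.log (c p.1) + m p.1 ^ 2) (κ.prod γ) := hgi.comp_fst γ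
  have j2 : Integrable (fun p : ρ × ℝ => 2 * m p.1 * c p.1 * p.2) (κ.prod γ) := hmc.mul_prod he1
  have j3 : Integrable (fun p : ρ × ℝ => (c p.1 ^ 2 - 1) * p.2 ^ 2) (κ.prod γ) := hcc.mul_prod he2
  have hfTi : Integrable (fun p : ρ × ℝ => f (p.1, m p.1 + c p.1 * p.2)) (κ.prod γ) := by
    simp only [hfT]; exact (j1.add j2).add j3
  have hfi : Integrable f P := by
    rw [hPdef, integrable_map_measure hfm.aestronglyMeasurable hT.aemeasurable]; exact hfTi
  have hint : Integrable (llr P (κ.prod γ)) P := hfi.congr hllr.symm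
  rw [klDiv_of_ac_of_integrable hac hint, integral_congr_ae hllr, hPdef,
    integral_map hT.aemeasurable hfm.aestronglyMeasurable, ← hPdef,
    ← ofReal_integral_eq_lintegral_ofReal hgi (ae_of_all _ hg0)]
  refine ENNReal.ofReal_le_ofReal ?_
  have j12 : Integrable (fun p : ρ × ℝ => -Real.log (c p.1) + m p.1 ^ 2 + 2 * m p.1 * c p.1 * p.2)
    (κ.prod γ) := j1.add j2
  simp only [hfT, probReal_univ]
  rw [integral_add j12 j3, integral_add j1 j2, integral_prod_mul (fun r => 2 * m r * c r)
    (fun x : ℝ => x), integral_prod_mul (fun r => c r ^ 2 - 1) (fun x : ℝ => x ^ 2),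
    hγ, integral_id_gaussianReal, integral_sq_gaussianReal_half,
    integral_fun_fst (fun r => -Real.log (c r) + m r ^ 2)]
  have hneg : ∫ r, (c r ^ 2 - 1) ∂κ ≤ 0 := integral_nonpos fun r => by
    have h1 := hc0 r
    have h2 := hc1 r
    simp only [Pi.zero_apply]; nlinarith
  simp only [probReal_univ, smul_eq_mul, one_mul]
  linarith

theorem condDiv_affine_gaussianReal_le {μ : Measure Ω} [IsProbabilityMeasure μ] {R : Ω → ρ}
    (hR : Measurable R) {e : Ω → ℝ} (he : Measurable e)
    (hind : (μ.map fun ω => (R ω, e ω)) = (μ.map R).prod (gaussianReal 0 (1 / 2))) {m c : ρ → ℝ}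
    (hm : Measurable m) (hc : Measurable c) (hc0 : ∀ r, 0 < c r) (hc1 : ∀ r, c r ≤ 1) :
    condDiv μ R (fun ω => m (R ω) + c (R ω) * e ω) (gaussianReal 0 (1 / 2)) ≤
      ∫⁻ ω, ENNReal.ofReal (-Real.log (c (R ω)) + m (R ω) ^ 2) ∂μ := by
  have : IsProbabilityMeasure (μ.map R) := Measure.isProbabilityMeasure_map hR.aemeasurable
  have h := klDiv_map_affine_gaussian_le (μ.map R) hm hc hc0 hc1
  rw [lintegral_map (by fun_prop) hR, ← hind, Measure.map_map (by fun_prop) (by fun_prop),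
    hind] at h
  exact h

/-- The real and imaginary parts of the noise are independent, so the chain rule splits the
divergence into two real ones, each with its own −log c. -/
theorem condDiv_affine_complexGaussian_le {μ : Measure Ω} [IsProbabilityMeasure μ] {R : Ω → ρ}
    (hR : Measurable R) {e : Ω → ℂ} (he : Measurable e)
    (hind : (μ.map fun ω => (R ω, e ω)) = (μ.map R).prod complexGaussian) {m : ρ → ℂ} {c : ρ → ℝ}
    (hm : Measurable m) (hc : Measurable c) (hc0 : ∀ r, 0 < c r) (hc1 : ∀ r, c r ≤ 1) :
    condDiv μ R (fun ω => m (R ω) + c (R ω) * e ω) complexGaussian ≤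
      ∫⁻ ω, ENNReal.ofReal (-2 * Real.log (c (R ω)) + ‖m (R ω)‖ ^ 2) ∂μ := by
  have : IsProbabilityMeasure (μ.map R) := Measure.isProbabilityMeasure_map hR.aemeasurable
  set γ := gaussianReal 0 (1 / 2) with hγ
  let toC : ℝ × ℝ → ℂ := fun p => ⟨p.1, p.2⟩
  have htoC : Measurable toC := Complex.measurableEquivRealProd.symm.measurable
  have hpC : MeasurePreserving toC (γ.prod γ) complexGaussian := ⟨htoC, rfl⟩
  let κ := μ.map R
  let μ' : Measure (ρ × ℝ × ℝ) := κ.prod (γ.prod γ)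
  let V : ρ × ℝ × ℝ → ℝ := fun p => (m p.1).re + c p.1 * p.2.1
  let W : ρ × ℝ × ℝ → ℝ := fun p => (m p.1).im + c p.1 * p.2.2
  have hre : Measurable fun r => (m r).re := Complex.measurable_re.comp hm
  have him : Measurable fun r => (m r).im := Complex.measurable_im.comp hm
  have hV : Measurable V := by simp only [V]; fun_prop
  have hW : Measurable W := by simp only [W]; fun_prop
  have hT : Measurable fun p : ρ × ℂ => (p.1, m p.1 + c p.1 * p.2) := by fun_prop
  have hfst : μ'.map Prod.fst = κ := by
    rw [Measure.map_fst_prod]; simp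
  have hlog : ∀ r, 0 ≤ -Real.log (c r) := fun r => by
    have := Real.log_nonpos (hc0 r).le (hc1 r); linarith
  have e1 : condDiv μ R (fun ω => m (R ω) + c (R ω) * e ω) complexGaussian =
      condDiv μ' Prod.fst (fun p => toC (V p, W p)) complexGaussian := by
    rw [condDiv, condDiv, hfst]
    congr 1
    have h1 : (μ.map fun ω => (R ω, m (R ω) + c (R ω) * e ω)) =
        (κ.prod complexGaussian).map fun p => (p.1, m p.1 + c p.1 * p.2) := by
      rw [← hind, Measure.map_map hT (hR.prodMk he)]; rfl
    have h2 : κ.prod complexGaussian = μ'.map (Prod.map id toC) := by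
      rw [← hpC.map_eq, ← Measure.map_prod_map _ _ measurable_id htoC, Measure.map_id]
    rw [h1, h2, Measure.map_map hT (measurable_id.prodMap htoC)]
    congr 1
    ext p
    · rfl
    · apply Complex.ext <;> simp [toC, V, W]
  have i1 : (μ'.map fun p => (p.1, p.2.1)) = κ.prod γ := by
    have : (fun p : ρ × ℝ × ℝ => (p.1, p.2.1)) = Prod.map id Prod.fst := rfl
    rw [this, ← Measure.map_prod_map _ _ measurable_id measurable_fst, Measure.map_id,
      Measure.map_fst_prod]
    simp
  have i2 : (μ'.map fun p => ((p.1, p.2.1), p.2.2)) = (μ'.map fun p => (p.1, p.2.1)).prod γ := by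
    rw [i1]
    exact (MeasurePreserving.symm _ (measurePreserving_prodAssoc κ γ γ)).map_eq
  calc condDiv μ R (fun ω => m (R ω) + c (R ω) * e ω) complexGaussian
      ≤ condDiv μ' Prod.fst (fun p => (V p, W p)) (γ.prod γ) := by
        rw [e1]; exact condDiv_comp_right_le measurable_fst (hV.prodMk hW) hpC
    _ = condDiv μ' Prod.fst V γ + condDiv μ' (fun p => (p.1, V p)) W γ :=
        condDiv_prod measurable_fst hV hW γ
    -- V is a function of `p.1` and the real noise `p.2.1`, so conditioning on that noise instead
    -- can only raise the divergence.
    _ ≤ condDiv μ' Prod.fst V γ + condDiv μ' (fun p => (p.1, p.2.1)) W γ := by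
        gcongr
        exact condDiv_comp_left_le (F := fun p : ρ × ℝ × ℝ => (p.1, p.2.1)) (by fun_prop) hW
          (φ := fun p => (p.1, (m p.1).re + c p.1 * p.2)) (by fun_prop)
    _ ≤ ∫⁻ p, ENNReal.ofReal (-Real.log (c p.1) + (m p.1).re ^ 2) ∂μ' +
        ∫⁻ p, ENNReal.ofReal (-Real.log (c p.1) + (m p.1).im ^ 2) ∂μ' := by
        refine add_le_add ?_ ?_
        · exact condDiv_affine_gaussianReal_le measurable_fst (e := fun p : ρ × ℝ × ℝ => p.2.1) (by fun_prop)
            (by rw [hfst]; exact i1) hre hc hc0 hc1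
        · exact condDiv_affine_gaussianReal_le (R := fun p : ρ × ℝ × ℝ => (p.1, p.2.1))
            (by fun_prop) (e := fun p : ρ × ℝ × ℝ => p.2.2) (by fun_prop) i2 (m := fun p => (m p.1).im)
            (c := fun p => c p.1) (by fun_prop) (by fun_prop) (fun _ => hc0 _) (fun _ => hc1 _)
    _ = ∫⁻ p, ENNReal.ofReal (-2 * Real.log (c p.1) + ‖m p.1‖ ^ 2) ∂μ' := by
        rw [← lintegral_add_left (by fun_prop)]
        refine lintegral_congr fun p => ?_
        rw [← ENNReal.ofReal_add (add_nonneg (hlog _) (sq_nonneg _))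
          (add_nonneg (hlog _) (sq_nonneg _)), ← Complex.normSq_eq_norm_sq, Complex.normSq_apply]
        congr 1; ring
    _ = ∫⁻ ω, ENNReal.ofReal (-2 * Real.log (c (R ω)) + ‖m (R ω)‖ ^ 2) ∂μ := by
        rw [← lintegral_map (μ := μ) (g := R)
          (f := fun r => ENNReal.ofReal (-2 * Real.log (c r) + ‖m r‖ ^ 2)) (by fun_prop) hR,
          show μ.map R = μ'.map Prod.fst from hfst.symm, lintegral_map (by fun_prop) measurable_fst]

end Gaussian

/-! ### Independence by redrawing one coordinate of a product. -/

section Resampling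

variable {ι A τ Θ : Type*} [Fintype ι] [DecidableEq ι] [MeasurableSpace A] [MeasurableSpace τ]
  [MeasurableSpace Θ]

theorem measurePreserving_update (α : Measure A) [IsProbabilityMeasure α] (i : ι) :
    MeasurePreserving (fun p : (ι → A) × A => Function.update p.1 i p.2)
      ((Measure.pi fun _ => α).prod α) (Measure.pi fun _ => α) := by
  have hmeas : Measurable fun p : (ι → A) × A => Function.update p.1 i p.2 :=
    measurable_pi_iff.2 fun j => by
      by_cases h : j = i
      · subst h; simpa using measurable_snd
      · simp only [Function.update_of_ne h]
        exact (measurable_pi_apply j).comp measurable_fst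
  refine ⟨hmeas, (Measure.pi_eq fun s hs => ?_).symm⟩
  rw [Measure.map_apply hmeas (MeasurableSet.univ_pi hs)]
  have : (fun p : (ι → A) × A => Function.update p.1 i p.2) ⁻¹' Set.univ.pi s =
      (Set.univ.pi (Function.update s i Set.univ)) ×ˢ s i := by
    ext ⟨f, a⟩
    simp only [Set.mem_preimage, Set.mem_univ_pi, Set.mem_prod]
    constructor
    · refine fun h => ⟨fun j => ?_, by simpa using h i⟩
      by_cases hj : j = i
      · subst hj; simp
      · simpa [Function.update_of_ne hj] using h j
    · rintro ⟨h1, h2⟩ j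
      by_cases hj : j = i
      · subst hj; simpa using h2
      · simpa [Function.update_of_ne hj] using h1 j
  rw [this, Measure.prod_prod, Measure.pi_pi, ← Finset.mul_prod_erase Finset.univ _
    (Finset.mem_univ i), ← Finset.mul_prod_erase Finset.univ (fun j => α (s j))
    (Finset.mem_univ i), Function.update_self, measure_univ, one_mul, mul_comm]
  congr 1
  refine Finset.prod_congr rfl fun j hj => ?_
  rw [Function.update_of_ne (Finset.ne_of_mem_erase hj)]

/-- The map φ allows only part of a coordinate to be redrawn: the fading vector with the noise kept,
or the reverse. -/
theorem measurePreserving_update_comp {α : Measure A} [IsProbabilityMeasure α] {κ : Measure τ}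
    [IsProbabilityMeasure κ] (i : ι) {φ : A × τ → A} (hφ : MeasurePreserving φ (α.prod κ) α) :
    MeasurePreserving (fun p : (ι → A) × τ => Function.update p.1 i (φ (p.1 i, p.2)))
      ((Measure.pi fun _ => α).prod κ) (Measure.pi fun _ => α) := by
  have hU := measurePreserving_update α i
  have hmeas : Measurable fun p : (ι → A) × τ => Function.update p.1 i (φ (p.1 i, p.2)) :=
    hU.measurable.comp (measurable_fst.prodMk (hφ.measurable.comp
      (((measurable_pi_apply i).comp measurable_fst).prodMk measurable_snd)))
  refine ⟨hmeas, ?_⟩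
  have h1 := hU.prod (MeasurePreserving.id κ)
  have h2 := hU.comp (((MeasurePreserving.id (Measure.pi fun _ : ι => α)).prod hφ).comp
    (measurePreserving_prodAssoc (Measure.pi fun _ : ι => α) α κ))
  -- Redrawing coordinate i beforehand changes no law, and turns the map into ((f, s), t) ↦ `update
  -- f i (φ (s, t))`, which is `h2`.
  rw [← h1.map_eq, Measure.map_map hmeas h1.measurable]
  refine Eq.trans ?_ h2.map_eq
  congr 1
  ext ⟨⟨f, s⟩, t⟩ : 1
  simp [MeasurableEquiv.prodAssoc]

/-- If `R` is unaffected by resampling the coordinate `i` while `X` becomes the fresh sample, then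
`X` is independent of `R`. -/
theorem map_prodMk_eq_prod_of_resample {ρ : Type*} [MeasurableSpace ρ] (π : Measure Θ)
    [IsProbabilityMeasure π] {α : Measure A} [IsProbabilityMeasure α] {κ : Measure τ}
    [IsProbabilityMeasure κ] (i : ι) {φ : A × τ → A} (hφ : MeasurePreserving φ (α.prod κ) α)
    {R : Θ × (ι → A) → ρ} (hR : Measurable R) {X : Θ × (ι → A) → τ} (hX : Measurable X)
    (hRφ : ∀ θ f t, R (θ, Function.update f i (φ (f i, t))) = R (θ, f))
    (hXφ : ∀ θ f t, X (θ, Function.update f i (φ (f i, t))) = t) :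
    ((π.prod (Measure.pi fun _ => α)).map fun ω => (R ω, X ω)) =
      ((π.prod (Measure.pi fun _ => α)).map R).prod κ := by
  have h := ((MeasurePreserving.id π).prod (measurePreserving_update_comp i hφ)).comp
    (measurePreserving_prodAssoc π (Measure.pi fun _ : ι => α) κ)
  conv_lhs => rw [← h.map_eq]
  rw [Measure.map_map (hR.prodMk hX) h.measurable]
  have h2 := Measure.map_prod_map (π.prod (Measure.pi fun _ : ι => α)) κ hR measurable_id
  rw [Measure.map_id] at h2
  rw [h2]
  congr 1
  ext ⟨⟨θ, f⟩, t⟩ : 1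
  exact Prod.ext (hRφ θ f t) (hXφ θ f t)

end Resampling

/-! ### Divergence of finite sequences from product laws. -/

section Sequences

variable {Ω 𝓕 𝓥 : Type*} [MeasurableSpace Ω] [MeasurableSpace 𝓕] [MeasurableSpace 𝓥]

/-- Chain rule for the last entry of a finite sequence. -/
theorem condDiv_pi_succ [StandardBorelSpace 𝓥] [Nonempty 𝓥] {μ : Measure Ω}
    [IsProbabilityMeasure μ] {F : Ω → 𝓕} (hF : Measurable F) {k : ℕ} {R : Fin (k + 1) → Ω → 𝓥}
    (hR : ∀ i, Measurable (R i)) (q : Measure 𝓥) [IsProbabilityMeasure q] :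
    condDiv μ F (fun ω i => R i ω) (Measure.pi fun _ => q) =
      condDiv μ F (fun ω (i : Fin k) => R i.castSucc ω) (Measure.pi fun _ => q) +
        condDiv μ (fun ω => (F ω, fun i : Fin k => R i.castSucc ω)) (R (Fin.last k)) q := by
  have hV : Measurable fun ω i => R i ω := measurable_pi_iff.2 hR
  have hV' : Measurable fun ω (i : Fin k) => R i.castSucc ω := measurable_pi_iff.2 fun i => hR _
  let e := (MeasurableEquiv.piFinSuccAbove (fun _ : Fin (k + 1) => 𝓥) (Fin.last k)).trans
    MeasurableEquiv.prodComm
  have he : MeasurePreserving e (Measure.pi fun _ => q) ((Measure.pi fun _ => q).prod q) :=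
    (Measure.measurePreserving_swap (μ := q) (ν := Measure.pi fun _ : Fin k => q)).comp
      (measurePreserving_piFinSuccAbove (fun _ : Fin (k + 1) => q) (Fin.last k))
  rw [← condDiv_comp_equiv hF hV e he]
  rw [← condDiv_prod hF hV' (hR _) q]
  congr 1
  ext ω : 1
  refine Prod.ext (funext fun i => ?_) rfl
  change R ((Fin.last k).succAbove i) ω = R i.castSucc ω
  rw [Fin.succAbove_last]

theorem condDiv_pi_zero {μ : Measure Ω} [IsProbabilityMeasure μ] {F : Ω → 𝓕} (hF : Measurable F)
    (V : Ω → Fin 0 → 𝓥) (q : Measure 𝓥) [IsProbabilityMeasure q] :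
    condDiv μ F V (Measure.pi fun _ => q) = 0 := by
  refine condDiv_eq_zero ?_
  rw [Measure.pi_of_empty, Measure.prod_dirac, Measure.map_map (by fun_prop) hF]
  congr 1
  ext ω : 1
  exact Prod.ext rfl (Subsingleton.elim _ _)

theorem measurePreserving_zipWith {ι A B C : Type*} [Fintype ι] [MeasurableSpace A]
    [MeasurableSpace B] [MeasurableSpace C] (a : Measure A) (b : Measure B) (c : Measure C)
    [IsProbabilityMeasure a] [IsProbabilityMeasure b] [IsProbabilityMeasure c]
    {κ : A × B → C} (hκ : MeasurePreserving κ (a.prod b) c) :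
    MeasurePreserving (fun (p : (ι → A) × (ι → B)) i => κ (p.1 i, p.2 i))
      ((Measure.pi fun _ => a).prod (Measure.pi fun _ => b)) (Measure.pi fun _ => c) :=
  (measurePreserving_pi (fun _ => a.prod b) (fun _ => c) fun _ => hκ).comp
    (MeasurePreserving.symm _ (measurePreserving_arrowProdEquivProdArrow A B ι
      (fun _ => a) (fun _ => b)))

end Sequences

noncomputable section

/-! ### Channel model with scaled outputs, and the cost of one output. -/

section Channel

variable {Θ 𝓕 𝓖 : Type*} [MeasurableSpace Θ] [MeasurableSpace 𝓕] [MeasurableSpace 𝓖] {M n : ℕ}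

/-- Transmitter-side randomness together with the fading and noise of both users (labelled by
`Bool`) at all times. -/
abbrev Primitives (Θ : Type*) (M n : ℕ) : Type _ := Θ × (Fin n × Bool → CVec M × ℂ)

/-- The joint law of the primitive random variables. -/
def primLaw (π : Measure Θ) (ν : Measure (CVec M)) (n : ℕ) : Measure (Primitives Θ M n) :=
  π.prod (Measure.pi fun _ => ν.prod complexGaussian)

instance (π : Measure Θ) (ν : Measure (CVec M)) [IsProbabilityMeasure π] [IsProbabilityMeasure ν] :
    IsProbabilityMeasure (primLaw π ν n) := by
  unfold primLaw; infer_instance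

/-- Fading vector of user `b` at time `t`. -/
def fading (t : Fin n) (b : Bool) (ω : Primitives Θ M n) : CVec M := (ω.2 (t, b)).1

/-- Noise of user `b` at time `t`. -/
def noise (t : Fin n) (b : Bool) (ω : Primitives Θ M n) : ℂ := (ω.2 (t, b)).2

/-- Scaling that normalizes the power of an output with fading vector `h` at input power `P`. -/
def gain (P : ℝ) (h : CVec M) : ℝ := (√(1 + P * ∑ i, ‖h i‖ ^ 2))⁻¹

/-- An input process with delayed channel state information. -/
structure IsCausalInput (x : Fin n → Primitives Θ M n → CVec M) : Prop where
  measurable : ∀ t, Measurable (x t)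
  congr : ∀ t θ f f', (∀ s < t, ∀ b, (f (s, b)).1 = (f' (s, b)).1) → x t (θ, f) = x t (θ, f')

/-- Noiseless normalized output. -/
def signal (x : Fin n → Primitives Θ M n → CVec M) (P : ℝ) (t : Fin n) (b : Bool)
    (ω : Primitives Θ M n) : ℂ := gain P (fading t b ω) * (fading t b ω ⬝ᵥ x t ω)

/-- Normalized output of user `b` at time `t`. -/
def output (x : Fin n → Primitives Θ M n → CVec M) (P : ℝ) (t : Fin n) (b : Bool)
    (ω : Primitives Θ M n) : ℂ := signal x P t b ω + gain P (fading t b ω) * noise t b ω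

/-- Fading vector and normalized output of user `b` at time `t`. -/
def received (x : Fin n → Primitives Θ M n → CVec M) (P : ℝ) (t : Fin n) (b : Bool)
    (ω : Primitives Θ M n) : CVec M × ℂ := (fading t b ω, output x P t b ω)

/-- What user `b` has seen up to time `k`: its outputs and all fading vectors. -/
def ownView (x : Fin n → Primitives Θ M n → CVec M) (P : ℝ) (b : Bool) {k : ℕ} (hk : k ≤ n)
    (ω : Primitives Θ M n) (i : Fin k) : (CVec M × ℂ) × CVec M :=
  (received x P (Fin.castLE hk i) b ω, fading (Fin.castLE hk i) (!b) ω)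

/-- What both users together have seen up to time `k`. -/
def jointView (x : Fin n → Primitives Θ M n → CVec M) (P : ℝ) (b : Bool) {k : ℕ} (hk : k ≤ n)
    (ω : Primitives Θ M n) (i : Fin k) : (CVec M × ℂ) × (CVec M × ℂ) :=
  (received x P (Fin.castLE hk i) b ω, received x P (Fin.castLE hk i) (!b) ω)

theorem gain_pos {P : ℝ} (hP : 0 ≤ P) (h : CVec M) : 0 < gain P h := by
  unfold gain
  have : 0 ≤ P * ∑ i, ‖h i‖ ^ 2 := mul_nonneg hP (Finset.sum_nonneg fun _ _ => sq_nonneg _)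
  positivity

theorem gain_le_one {P : ℝ} (hP : 0 ≤ P) (h : CVec M) : gain P h ≤ 1 := by
  unfold gain
  have : 0 ≤ P * ∑ i, ‖h i‖ ^ 2 := mul_nonneg hP (Finset.sum_nonneg fun _ _ => sq_nonneg _)
  refine inv_le_one_of_one_le₀ (Real.one_le_sqrt.2 (by linarith))

@[fun_prop]
theorem measurable_gain (P : ℝ) : Measurable (gain P : CVec M → ℝ) := by
  unfold gain; fun_prop

@[fun_prop]
theorem measurable_fading (t : Fin n) (b : Bool) :
    Measurable (fading t b : Primitives Θ M n → CVec M) := by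
  unfold fading; fun_prop

@[fun_prop]
theorem measurable_noise (t : Fin n) (b : Bool) :
    Measurable (noise t b : Primitives Θ M n → ℂ) := by
  unfold noise; fun_prop

variable {x : Fin n → Primitives Θ M n → CVec M} (hx : IsCausalInput x) (P : ℝ)

include hx

theorem IsCausalInput.measurable_signal (t : Fin n) (b : Bool) : Measurable (signal x P t b) := by
  have := hx.measurable t
  unfold signal dotProduct
  fun_prop

theorem IsCausalInput.measurable_output (t : Fin n) (b : Bool) : Measurable (output x P t b) := by
  have := hx.measurable_signal P t b
  unfold output
  fun_prop

theorem IsCausalInput.measurable_received (t : Fin n) (b : Bool) :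
    Measurable (received x P t b) := by
  have := hx.measurable_output P t b
  unfold received
  fun_prop

theorem IsCausalInput.measurable_ownView (b : Bool) {k : ℕ} (hk : k ≤ n) :
    Measurable (ownView x P b hk) :=
  measurable_pi_iff.2 fun _ => (hx.measurable_received P _ _).prodMk (measurable_fading _ _)

theorem IsCausalInput.measurable_jointView (b : Bool) {k : ℕ} (hk : k ≤ n) :
    Measurable (jointView x P b hk) :=
  measurable_pi_iff.2 fun _ => (hx.measurable_received P _ _).prodMk (hx.measurable_received P _ _)

theorem IsCausalInput.signal_congr (t : Fin n) (b : Bool) (θ : Θ)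
    {f f' : Fin n × Bool → CVec M × ℂ} (h1 : (f (t, b)).1 = (f' (t, b)).1)
    (h2 : ∀ s < t, ∀ b, (f (s, b)).1 = (f' (s, b)).1) :
    signal x P t b (θ, f) = signal x P t b (θ, f') := by
  simp only [signal, fading, h1, hx.congr t θ f f' h2]

theorem IsCausalInput.received_congr (t : Fin n) (b : Bool) (θ : Θ)
    {f f' : Fin n × Bool → CVec M × ℂ} (h1 : f (t, b) = f' (t, b))
    (h2 : ∀ s < t, ∀ b, (f (s, b)).1 = (f' (s, b)).1) :
    received x P t b (θ, f) = received x P t b (θ, f') := by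
  simp only [received, output, fading, noise, h1, hx.signal_congr P t b θ (by rw [h1]) h2]

variable (π : Measure Θ) [IsProbabilityMeasure π] (ν : Measure (CVec M)) [IsProbabilityMeasure ν]

omit hx in
/-- A fading vector is independent of everything that does not involve it. -/
theorem map_prodMk_fading {R : Primitives Θ M n → 𝓖} (hR : Measurable R) (t : Fin n) (b : Bool)
    (hRt : ∀ θ f h, R (θ, Function.update f (t, b) (h, (f (t, b)).2)) = R (θ, f)) :
    ((primLaw π ν n).map fun ω => (R ω, fading t b ω)) = ((primLaw π ν n).map R).prod ν := by
  have hφ : MeasurePreserving (fun p : (CVec M × ℂ) × CVec M => (p.2, p.1.2))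
      ((ν.prod complexGaussian).prod ν) (ν.prod complexGaussian) :=
    (Measure.measurePreserving_swap (μ := complexGaussian) (ν := ν)).comp
      ((measurePreserving_snd (μ := ν) (ν := complexGaussian)).prod (MeasurePreserving.id ν))
  exact map_prodMk_eq_prod_of_resample π (t, b) hφ hR (measurable_fading t b) hRt
    (fun θ f h => by simp [fading])

omit hx in
/-- A noise variable is independent of everything that does not involve it. -/
theorem map_prodMk_noise {R : Primitives Θ M n → 𝓖} (hR : Measurable R) (t : Fin n) (b : Bool)
    (hRt : ∀ θ f e, R (θ, Function.update f (t, b) ((f (t, b)).1, e)) = R (θ, f)) :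
    ((primLaw π ν n).map fun ω => (R ω, noise t b ω)) =
      ((primLaw π ν n).map R).prod complexGaussian := by
  have hφ : MeasurePreserving (fun p : (CVec M × ℂ) × ℂ => (p.1.1, p.2))
      ((ν.prod complexGaussian).prod complexGaussian) (ν.prod complexGaussian) :=
    (measurePreserving_fst (μ := ν) (ν := complexGaussian)).prod
      (MeasurePreserving.id complexGaussian)
  exact map_prodMk_eq_prod_of_resample π (t, b) hφ hR (measurable_noise t b) hRt
    (fun θ f h => by simp [noise])

/-- Single-letter bound on the divergence of an output of user `b` from the Gaussian law. -/
def stepCost (x : Fin n → Primitives Θ M n → CVec M) (P : ℝ) (μ : Measure (Primitives Θ M n))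
    (t : Fin n) (b : Bool) : ℝ≥0∞ :=
  ∫⁻ ω, ENNReal.ofReal (-2 * Real.log (gain P (fading t b ω)) + ‖signal x P t b ω‖ ^ 2) ∂μ

variable {P}

/-- Enlarge the conditioning to all primitives except the current noise; given these the output is
affine in an independent Gaussian. -/
theorem condDiv_output_le (hP : 0 ≤ P) {R : Primitives Θ M n → 𝓖} (hR : Measurable R) (t : Fin n)
    (b : Bool) (hRt : ∀ θ f e, R (θ, Function.update f (t, b) ((f (t, b)).1, e)) = R (θ, f)) :
    condDiv (primLaw π ν n) R (output x P t b) complexGaussian ≤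
      stepCost x P (primLaw π ν n) t b := by
  -- S erases the noise (t, b). Neither R, nor the current fading, nor the signal sees that noise,
  -- so all of them factor through S.
  let S : Primitives Θ M n → Primitives Θ M n := fun ω =>
    (ω.1, Function.update ω.2 (t, b) ((ω.2 (t, b)).1, 0))
  have hS : Measurable S := by
    refine measurable_fst.prodMk (measurable_pi_iff.2 fun j => ?_)
    by_cases hj : j = (t, b)
    · subst hj; simp only [Function.update_self]; fun_prop
    · simp only [Function.update_of_ne hj]; fun_prop
  have hSt : ∀ θ f e, S (θ, Function.update f (t, b) ((f (t, b)).1, e)) = S (θ, f) := by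
    intro θ f e; simp [S]
  have hfad : ∀ ω, fading t b (S ω) = fading t b ω := fun ω => by simp [S, fading]
  have hsig : ∀ ω, signal x P t b (S ω) = signal x P t b ω := by
    rintro ⟨θ, f⟩
    refine hx.signal_congr P t b θ (by simp) fun s hs b' => ?_
    rw [Function.update_of_ne (by simp [hs.ne])]
  have hout : output x P t b = fun ω =>
      signal x P t b (S ω) + gain P (fading t b (S ω)) * noise t b ω := by
    ext ω; rw [hsig, hfad, output]
  have hRS : R = fun ω => R (S ω) := by
    ext ⟨θ, f⟩; exact (hRt θ f 0).symm
  have h := condDiv_affine_complexGaussian_le hS (measurable_noise t b)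
    (map_prodMk_noise π ν hS t b hSt) (hx.measurable_signal P t b)
    (c := fun ω => gain P (fading t b ω)) (by fun_prop) (fun _ => gain_pos hP _)
    (fun _ => gain_le_one hP _)
  simp only [hsig, hfad] at h
  refine le_trans ?_ h
  rw [hRS]
  exact condDiv_comp_left_le hS (hx.measurable_output P t b) hR

/-- Bound on the divergence of all outputs of one user, conditionally on variables that do not
involve its noise. -/
theorem condDiv_outputs_le (hP : 0 ≤ P) {R : Primitives Θ M n → 𝓖} (hR : Measurable R) (b : Bool)
    (hRt : ∀ t θ f e, R (θ, Function.update f (t, b) ((f (t, b)).1, e)) = R (θ, f)) :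
    ∀ {k : ℕ} (hk : k ≤ n), condDiv (primLaw π ν n) R
      (fun ω (i : Fin k) => output x P (Fin.castLE hk i) b ω) (Measure.pi fun _ => complexGaussian) ≤
      ∑ i : Fin k, stepCost x P (primLaw π ν n) (Fin.castLE hk i) b := by
  intro k
  induction k with
  | zero => intro hk; rw [condDiv_pi_zero hR]; exact zero_le
  | succ k ih =>
    intro hk
    rw [condDiv_pi_succ hR (fun i => hx.measurable_output P (Fin.castLE hk i) b),
      Fin.sum_univ_castSucc]
    refine add_le_add (ih (Nat.le_of_succ_le hk)) ?_
    -- Earlier outputs join the conditioning. Inputs depend on fading but on no noise, so these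
    -- outputs do not involve the current noise.
    refine condDiv_output_le hx π ν hP
      (hR.prodMk (measurable_pi_iff.2 fun i => hx.measurable_output P _ b)) _ b fun θ f e => ?_
    refine Prod.ext (hRt _ _ _ _) (funext fun i => ?_)
    refine congrArg Prod.snd (hx.received_congr P (Fin.castLE hk i.castSucc) b θ ?_ fun s hs b' => ?_)
    · rw [Function.update_of_ne]
      simp [Fin.ext_iff, i.isLt.ne]
    · rw [Function.update_of_ne]
      have : (s : ℕ) < i := hs
      have := i.isLt
      simp only [ne_eq, Prod.mk.injEq, not_and, Fin.ext_iff, Fin.val_castLE, Fin.val_last]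
      omega

end Channel

/-! ### Comparison of the view of one user with the joint view. -/

section Converse

variable {Θ 𝓕 𝓖 : Type*} [MeasurableSpace Θ] [MeasurableSpace 𝓕] [MeasurableSpace 𝓖] {M n : ℕ}
variable {x : Fin n → Primitives Θ M n → CVec M} (hx : IsCausalInput x) (P : ℝ)
  (π : Measure Θ) [IsProbabilityMeasure π] (ν : Measure (CVec M)) [IsProbabilityMeasure ν]

include hx

/-- The view of both users up to time `k` does not involve later primitives. -/
theorem IsCausalInput.jointView_congr (b : Bool) {k : ℕ} (hk : k ≤ n) (θ : Θ)
    {f f' : Fin n × Bool → CVec M × ℂ} (h : ∀ s : Fin n, (s : ℕ) < k → ∀ b, f (s, b) = f' (s, b)) :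
    jointView x P b hk (θ, f) = jointView x P b hk (θ, f') := by
  have hs : ∀ (i : Fin k) (s : Fin n), s < Fin.castLE hk i → (s : ℕ) < k := fun i s hs =>
    lt_trans (show (s : ℕ) < i from hs) i.isLt
  ext1 i
  exact Prod.ext
    (hx.received_congr P _ _ θ (h _ i.isLt _) fun s h' b => by rw [h s (hs i s h')])
    (hx.received_congr P _ _ θ (h _ i.isLt _) fun s h' b => by rw [h s (hs i s h')])

omit hx [MeasurableSpace Θ] in
theorem ownView_eq (b : Bool) {k : ℕ} (hk : k ≤ n) (ω : Primitives Θ M n) :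
    ownView x P b hk ω = fun i => ((jointView x P b hk ω i).1, (jointView x P b hk ω i).2.1) := rfl

theorem IsCausalInput.ownView_congr (b : Bool) {k : ℕ} (hk : k ≤ n) (θ : Θ)
    {f f' : Fin n × Bool → CVec M × ℂ} (h : ∀ s : Fin n, (s : ℕ) < k → ∀ b, f (s, b) = f' (s, b)) :
    ownView x P b hk (θ, f) = ownView x P b hk (θ, f') := by
  rw [ownView_eq, ownView_eq, hx.jointView_congr P b hk θ h]

/-- Statistical equivalence of the two users: conditionally on the past, the current outputs of
both users have the same law. -/
theorem map_received_eq {F : Θ → 𝓕} (hF : Measurable F) (b : Bool) {k : ℕ} (hk : k < n) :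
    ((primLaw π ν n).map fun ω => ((F ω.1, jointView x P b hk.le ω), received x P ⟨k, hk⟩ b ω)) =
      (primLaw π ν n).map fun ω =>
        ((F ω.1, jointView x P b hk.le ω), received x P ⟨k, hk⟩ (!b) ω) := by
  -- Exchanging the primitives of the two users at time k preserves the law. The past and the input
  -- at time k, which sees strictly earlier fading only, are unchanged, while the two received
  -- values trade places.
  let σ : Fin n × Bool ≃ Fin n × Bool := Equiv.swap (⟨k, hk⟩, b) (⟨k, hk⟩, !b)
  have hpi : MeasurePreserving (fun (f : Fin n × Bool → CVec M × ℂ) i => f (σ i))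
      (Measure.pi fun _ => ν.prod complexGaussian) (Measure.pi fun _ => ν.prod complexGaussian) :=
    measurePreserving_arrowCongr' (fun _ => ν.prod complexGaussian) (fun _ => ν.prod complexGaussian)
      σ.symm (MeasurableEquiv.refl _) fun _ => MeasurePreserving.id _
  have hS : MeasurePreserving (Prod.map id fun f i => f (σ i)) (primLaw π ν n) (primLaw π ν n) :=
    (MeasurePreserving.id π).prod hpi
  have hne : ∀ (s : Fin n) (c : Bool), (s : ℕ) < k → σ (s, c) = (s, c) := fun s c hs =>
    Equiv.swap_apply_of_ne_of_ne (by simp [Fin.ext_iff, hs.ne]) (by simp [Fin.ext_iff, hs.ne])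
  have hF' : Measurable fun ω : Primitives Θ M n => F ω.1 := hF.comp measurable_fst
  have hJ := hx.measurable_jointView P b hk.le
  have hr := hx.measurable_received P ⟨k, hk⟩
  conv_lhs => rw [← hS.map_eq]
  rw [Measure.map_map ((hF'.prodMk hJ).prodMk (hr b)) hS.measurable]
  congr 1
  ext ⟨θ, f⟩ : 1
  refine Prod.ext (Prod.ext rfl ?_) ?_
  · exact hx.jointView_congr P b hk.le θ fun s hs c => by simp only [hne s c hs]
  · have h1 : received x P ⟨k, hk⟩ b (θ, fun i => f (σ i)) =
        (fun p : CVec M × ℂ => p) (received x P ⟨k, hk⟩ (!b) (θ, f)) := by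
      have hx' : x ⟨k, hk⟩ (θ, fun i => f (σ i)) = x ⟨k, hk⟩ (θ, f) :=
        hx.congr _ θ _ _ fun s hs c => by simp only [hne s c hs]
      have hσ : σ (⟨k, hk⟩, b) = (⟨k, hk⟩, !b) := Equiv.swap_apply_left _ _
      simp only [received, output, signal, fading, noise, hx', hσ]
    exact h1

/-- The current fading vector is independent of the past and of the output of the other user. -/
theorem map_fading_eq {F : Θ → 𝓕} (hF : Measurable F) (b : Bool) {k : ℕ} (hk : k < n) :
    ((primLaw π ν n).map fun ω => (((F ω.1, ownView x P b hk.le ω), received x P ⟨k, hk⟩ b ω),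
        fading ⟨k, hk⟩ (!b) ω)) =
      ((primLaw π ν n).map fun ω =>
        ((F ω.1, ownView x P b hk.le ω), received x P ⟨k, hk⟩ b ω)).prod ν := by
  refine map_prodMk_fading π ν (((hF.comp measurable_fst).prodMk
    (hx.measurable_ownView P b hk.le)).prodMk (hx.measurable_received P _ b)) _ _ fun θ f h => ?_
  have hlt : ∀ s : Fin n, (s : ℕ) < k → ∀ c, Function.update f (⟨k, hk⟩, !b)
      (h, (f (⟨k, hk⟩, !b)).2) (s, c) = f (s, c) := fun s hs c =>
    Function.update_of_ne (by simp [Fin.ext_iff, hs.ne]) _ _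
  refine Prod.ext (Prod.ext rfl (hx.ownView_congr P b hk.le θ hlt)) ?_
  refine hx.received_congr P _ b θ (Function.update_of_ne (by simp) _ _) fun s hs c => ?_
  rw [hlt s hs c]

/-- The fading vector of user `!b` contributes nothing to the increments of the view of `b`. -/
theorem condDiv_ownView_succ {F : Θ → 𝓕} (hF : Measurable F) (b : Bool) {k : ℕ} (hk : k < n) :
    condDiv (primLaw π ν n) (fun ω => F ω.1) (ownView x P b (Nat.succ_le_of_lt hk))
        (Measure.pi fun _ => (ν.prod complexGaussian).prod ν) =
      condDiv (primLaw π ν n) (fun ω => F ω.1) (ownView x P b hk.le)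
          (Measure.pi fun _ => (ν.prod complexGaussian).prod ν) +
        condDiv (primLaw π ν n) (fun ω => (F ω.1, ownView x P b hk.le ω))
          (received x P ⟨k, hk⟩ b) (ν.prod complexGaussian) := by
  have hF' : Measurable fun ω : Primitives Θ M n => F ω.1 := hF.comp measurable_fst
  have h := condDiv_pi_succ (μ := primLaw π ν n) hF'
    (R := fun i ω => ownView x P b (Nat.succ_le_of_lt hk) ω i)
    (fun i => (measurable_pi_apply i).comp (hx.measurable_ownView P b _))
    ((ν.prod complexGaussian).prod ν)
  refine h.trans ?_
  congr 1
  refine (condDiv_prod (hF'.prodMk (hx.measurable_ownView P b hk.le))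
    (hx.measurable_received P ⟨k, hk⟩ b) (measurable_fading _ _) ν).trans ?_
  exact (congrArg (_ + ·) (condDiv_eq_zero (map_fading_eq hx P π ν hF b hk))).trans (add_zero _)

theorem condDiv_jointView_succ {F : Θ → 𝓕} (hF : Measurable F) (b : Bool) {k : ℕ} (hk : k < n) :
    condDiv (primLaw π ν n) (fun ω => F ω.1) (jointView x P b (Nat.succ_le_of_lt hk))
        (Measure.pi fun _ => (ν.prod complexGaussian).prod (ν.prod complexGaussian)) =
      condDiv (primLaw π ν n) (fun ω => F ω.1) (jointView x P b hk.le)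
          (Measure.pi fun _ => (ν.prod complexGaussian).prod (ν.prod complexGaussian)) +
        (condDiv (primLaw π ν n) (fun ω => (F ω.1, jointView x P b hk.le ω))
          (received x P ⟨k, hk⟩ b) (ν.prod complexGaussian) +
        condDiv (primLaw π ν n)
          (fun ω => ((F ω.1, jointView x P b hk.le ω), received x P ⟨k, hk⟩ b ω))
          (received x P ⟨k, hk⟩ (!b)) (ν.prod complexGaussian)) := by
  have hF' : Measurable fun ω : Primitives Θ M n => F ω.1 := hF.comp measurable_fst
  have h := condDiv_pi_succ (μ := primLaw π ν n) hF'
    (R := fun i ω => jointView x P b (Nat.succ_le_of_lt hk) ω i)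
    (fun i => (measurable_pi_apply i).comp (hx.measurable_jointView P b _))
    ((ν.prod complexGaussian).prod (ν.prod complexGaussian))
  refine h.trans ?_
  congr 1
  exact condDiv_prod (hF'.prodMk (hx.measurable_jointView P b hk.le))
    (hx.measurable_received P ⟨k, hk⟩ b) (hx.measurable_received P ⟨k, hk⟩ (!b)) _

/-- The view of both users diverges at least twice as much from the reference law as the view
of one of them. -/
theorem two_mul_condDiv_ownView_le {F : Θ → 𝓕} (hF : Measurable F) (b : Bool) :
    ∀ {k : ℕ} (hk : k ≤ n),
      2 * condDiv (primLaw π ν n) (fun ω => F ω.1) (ownView x P b hk)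
          (Measure.pi fun _ => (ν.prod complexGaussian).prod ν) ≤
        condDiv (primLaw π ν n) (fun ω => F ω.1) (jointView x P b hk)
          (Measure.pi fun _ => (ν.prod complexGaussian).prod (ν.prod complexGaussian)) := by
  intro k
  have hF' : Measurable fun ω : Primitives Θ M n => F ω.1 := hF.comp measurable_fst
  induction k with
  | zero => intro hk; rw [condDiv_pi_zero hF']; simp
  | succ k ih =>
    intro hk
    have hk' : k < n := hk
    have hJ := hF'.prodMk (hx.measurable_jointView P b hk'.le)
    have hr := hx.measurable_received P ⟨k, hk'⟩
    rw [condDiv_ownView_succ hx P π ν hF b hk', condDiv_jointView_succ hx P π ν hF b hk', mul_add]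
    refine add_le_add (ih hk'.le) ?_
    have h1 : condDiv (primLaw π ν n) (fun ω => (F ω.1, ownView x P b hk'.le ω))
        (received x P ⟨k, hk'⟩ b) (ν.prod complexGaussian) ≤
        condDiv (primLaw π ν n) (fun ω => (F ω.1, jointView x P b hk'.le ω))
          (received x P ⟨k, hk'⟩ b) (ν.prod complexGaussian) :=
      condDiv_comp_left_le hJ (hr b) (φ := fun p => (p.1, fun i => ((p.2 i).1, (p.2 i).2.1)))
        (by fun_prop)
    -- By symmetry the output of b may be replaced by that of the other user under the same past;
    -- the output of b is then added to the conditioning.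
    have h2 : condDiv (primLaw π ν n) (fun ω => (F ω.1, jointView x P b hk'.le ω))
        (received x P ⟨k, hk'⟩ b) (ν.prod complexGaussian) ≤
        condDiv (primLaw π ν n)
          (fun ω => ((F ω.1, jointView x P b hk'.le ω), received x P ⟨k, hk'⟩ b ω))
          (received x P ⟨k, hk'⟩ (!b)) (ν.prod complexGaussian) := by
      rw [condDiv_congr (map_received_eq hx P π ν hF b hk')]
      exact condDiv_comp_left_le (hJ.prodMk (hr b)) (hr !b) measurable_fst
    rw [two_mul]
    exact add_le_add h1 (h1.trans h2)

variable {P}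

/-- The current fading vector is independent of the past with law ν and costs nothing, so only the
outputs are paid for. The resulting finiteness is what later allows D(V') to be cancelled. -/
theorem condDiv_ownView_le (hP : 0 ≤ P) {F : Θ → 𝓕} (hF : Measurable F) (b : Bool) :
    ∀ {k : ℕ} (hk : k ≤ n),
      condDiv (primLaw π ν n) (fun ω => F ω.1) (ownView x P b hk)
          (Measure.pi fun _ => (ν.prod complexGaussian).prod ν) ≤
        ∑ i : Fin k, stepCost x P (primLaw π ν n) (Fin.castLE hk i) b := by
  intro k
  have hF' : Measurable fun ω : Primitives Θ M n => F ω.1 := hF.comp measurable_fst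
  induction k with
  | zero => intro hk; rw [condDiv_pi_zero hF']; simp
  | succ k ih =>
    intro hk
    have hk' : k < n := hk
    rw [condDiv_ownView_succ hx P π ν hF b hk', Fin.sum_univ_castSucc]
    refine add_le_add (ih hk'.le) ?_
    have hO := hF'.prodMk (hx.measurable_ownView P b hk'.le)
    have h1 := condDiv_prod (μ := primLaw π ν n) hO (measurable_fading ⟨k, hk'⟩ b)
      (hx.measurable_output P ⟨k, hk'⟩ b) (q := ν) complexGaussian
    have hup : ∀ θ (f : Fin n × Bool → CVec M × ℂ) a,
        (F θ, ownView x P b hk'.le (θ, Function.update f (⟨k, hk'⟩, b) a)) =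
          (F θ, ownView x P b hk'.le (θ, f)) := fun θ f a =>
      Prod.ext rfl (hx.ownView_congr P b hk'.le θ fun s hs c =>
        Function.update_of_ne (by simp [Fin.ext_iff, hs.ne]) _ _)
    rw [condDiv_eq_zero (map_prodMk_fading π ν hO _ _ fun θ f h => hup θ f _), zero_add] at h1
    refine h1.le.trans (condDiv_output_le hx π ν hP (hO.prodMk (measurable_fading _ _)) _ _
      fun θ f e => Prod.ext (hup θ f _) (by simp [fading]))

/-- The output of a second user costs at most its own single-letter bounds. -/
theorem condDiv_jointView_le (hP : 0 ≤ P) {F : Θ → 𝓕} (hF : Measurable F) (b : Bool) :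
    condDiv (primLaw π ν n) (fun ω => F ω.1) (jointView x P b le_rfl)
        (Measure.pi fun _ => (ν.prod complexGaussian).prod (ν.prod complexGaussian)) ≤
      condDiv (primLaw π ν n) (fun ω => F ω.1) (ownView x P b le_rfl)
          (Measure.pi fun _ => (ν.prod complexGaussian).prod ν) +
        ∑ i : Fin n, stepCost x P (primLaw π ν n) i (!b) := by
  have hF' : Measurable fun ω : Primitives Θ M n => F ω.1 := hF.comp measurable_fst
  have hO := hx.measurable_ownView P b (le_refl n)
  have hY : Measurable fun ω (i : Fin n) => output x P i (!b) ω :=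
    measurable_pi_iff.2 fun i => hx.measurable_output P i _
  -- A view already contains all fading vectors, so the joint view is that view together with the
  -- other user's outputs, regrouped.
  have hzip := measurePreserving_zipWith (ι := Fin n) _ _ _
    (measurePreserving_prodAssoc (ν.prod complexGaussian) ν complexGaussian)
  refine (condDiv_comp_right_le (μ := primLaw π ν n) hF' (hO.prodMk hY) hzip).trans ?_
  rw [condDiv_prod hF' hO hY]
  gcongr
  -- Inputs ignore all noise, so the view of b involves no noise of the other user, at any time.
  refine condDiv_outputs_le hx π ν hP (hF'.prodMk hO) (!b) (fun t θ f e => ?_) (le_refl n)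
  refine Prod.ext rfl (funext fun i => Prod.ext ?_ ?_)
  · refine hx.received_congr P _ b θ (Function.update_of_ne (by simp) _ _) fun s hs c => ?_
    by_cases h : (s, c) = (t, !b)
    · rw [← h]; simp
    · rw [Function.update_of_ne h]
  · simp only [ownView, fading]
    by_cases h : (Fin.castLE le_rfl i, !b) = (t, !b)
    · rw [← h]; simp
    · rw [Function.update_of_ne h]

/-- The joint views of the two users in either order have the same divergence. -/
theorem condDiv_jointView_not_le {F : Θ → 𝓕} (hF : Measurable F)
    (b : Bool) :
    condDiv (primLaw π ν n) (fun ω => F ω.1) (jointView x P b le_rfl)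
        (Measure.pi fun _ => (ν.prod complexGaussian).prod (ν.prod complexGaussian)) ≤
      condDiv (primLaw π ν n) (fun ω => F ω.1) (jointView x P (!b) le_rfl)
        (Measure.pi fun _ => (ν.prod complexGaussian).prod (ν.prod complexGaussian)) := by
  have h := condDiv_comp_right_le (μ := primLaw π ν n) (hF.comp measurable_fst)
    (hx.measurable_jointView P (!b) (le_refl n)) (measurePreserving_pi (ι := Fin n)
      (fun _ => (ν.prod complexGaussian).prod (ν.prod complexGaussian))
      (fun _ => (ν.prod complexGaussian).prod (ν.prod complexGaussian))
      fun _ => Measure.measurePreserving_swap)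
  refine le_trans (le_of_eq ?_) h
  congr 1
  ext1 ω
  ext1 i
  simp [jointView]

/-- Sum of the single-letter bounds under an average power constraint. -/
theorem sum_stepCost_le (hP : 1 ≤ P)
    (hν : Integrable (fun h : CVec M => Real.log (1 + ∑ i, ‖h i‖ ^ 2)) ν)
    (hpow : ∫⁻ ω, ∑ t, ∑ i, ‖x t ω i‖ₑ ^ 2 ∂(primLaw π ν n) ≤ n * ENNReal.ofReal P) (b : Bool) :
    ∑ t : Fin n, stepCost x P (primLaw π ν n) t b ≤
      ENNReal.ofReal (n * (Real.log P + ∫ h, Real.log (1 + ∑ i, ‖h i‖ ^ 2) ∂ν + 1)) := by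
  have hP0 : 0 < P := by linarith
  have hs0 : ∀ h : CVec M, 0 ≤ ∑ i, ‖h i‖ ^ 2 := fun h => Finset.sum_nonneg fun _ _ => sq_nonneg _
  have hlog0 : ∀ h : CVec M, 0 ≤ Real.log (1 + ∑ i, ‖h i‖ ^ 2) := fun h =>
    Real.log_nonneg (by linarith [hs0 h])
  have hlm : Measurable fun h : CVec M => Real.log (1 + ∑ i, ‖h i‖ ^ 2) := by fun_prop
  -- Here −2 log gain = log(1 + P‖h‖²) ≤ log P + log(1 + ‖h‖²), since P ≥ 1, and Cauchy–Schwarz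
  -- bounds |signal|² by ‖x‖²/P. The power constraint makes the last terms sum to at most n.
  have key : ∀ t ω, ENNReal.ofReal (-2 * Real.log (gain P (fading t b ω)) +
      ‖signal x P t b ω‖ ^ 2) ≤ ENNReal.ofReal (Real.log P) +
        ENNReal.ofReal (Real.log (1 + ∑ i, ‖fading t b ω i‖ ^ 2)) +
          (∑ i, ‖x t ω i‖ₑ ^ 2) / ENNReal.ofReal P := by
    intro t ω
    set h := fading t b ω with hh
    have hv : 0 < 1 + P * ∑ i, ‖h i‖ ^ 2 := by have := mul_nonneg hP0.le (hs0 h); linarith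
    have e1 : (∑ i, ‖x t ω i‖ₑ ^ 2) / ENNReal.ofReal P =
        ENNReal.ofReal ((∑ i, ‖x t ω i‖ ^ 2) / P) := by
      rw [ENNReal.ofReal_div_of_pos hP0, ENNReal.ofReal_sum_of_nonneg fun _ _ => sq_nonneg _]
      congr 1
      refine Finset.sum_congr rfl fun i _ => ?_
      rw [← ofReal_norm, ENNReal.ofReal_pow (norm_nonneg _)]
    rw [e1, ← ENNReal.ofReal_add (Real.log_nonneg hP) (hlog0 h), ← ENNReal.ofReal_add
      (add_nonneg (Real.log_nonneg hP) (hlog0 h)) (div_nonneg (hs0 _) hP0.le)]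
    refine ENNReal.ofReal_le_ofReal (add_le_add ?_ ?_)
    · rw [gain, Real.log_inv, Real.log_sqrt hv.le, ← Real.log_mul hP0.ne' (by linarith [hs0 h])]
      have : -2 * -(Real.log (1 + P * ∑ i, ‖h i‖ ^ 2) / 2) = Real.log (1 + P * ∑ i, ‖h i‖ ^ 2) := by
        ring
      rw [this]
      exact Real.log_le_log hv (by nlinarith [hs0 h])
    · have hcs : ‖h ⬝ᵥ x t ω‖ ^ 2 ≤ (∑ i, ‖h i‖ ^ 2) * ∑ i, ‖x t ω i‖ ^ 2 := by
        refine le_trans (pow_le_pow_left₀ (norm_nonneg _) (norm_sum_le _ _) 2) ?_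
        simp only [norm_mul]
        exact Finset.sum_mul_sq_le_sq_mul_sq _ _ _
      rw [signal, norm_mul, mul_pow, ← hh, Complex.norm_real, gain, norm_inv, inv_pow,
        Real.norm_eq_abs, sq_abs, Real.sq_sqrt hv.le, inv_mul_le_iff₀ hv, mul_div_assoc',
        le_div_iff₀ hP0]
      nlinarith [hs0 (x t ω), hs0 h]
  have hfad : ∀ t : Fin n, ∫⁻ ω, ENNReal.ofReal (Real.log (1 + ∑ i, ‖fading t b ω i‖ ^ 2))
      ∂(primLaw π ν n) = ENNReal.ofReal (∫ h, Real.log (1 + ∑ i, ‖h i‖ ^ 2) ∂ν) := by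
    intro t
    have hmp : MeasurePreserving (fading t b) (primLaw π ν n) ν :=
      (measurePreserving_fst (μ := ν) (ν := complexGaussian)).comp
        ((measurePreserving_eval (fun _ : Fin n × Bool => ν.prod complexGaussian) (t, b)).comp
          (measurePreserving_snd (μ := π)
            (ν := Measure.pi fun _ : Fin n × Bool => ν.prod complexGaussian)))
    rw [hmp.lintegral_comp (f := fun h => ENNReal.ofReal (Real.log (1 + ∑ i, ‖h i‖ ^ 2)))
      (by fun_prop), ofReal_integral_eq_lintegral_ofReal hν (ae_of_all _ hlog0)]
  have hxm : ∀ t, Measurable fun ω => ∑ i, ‖x t ω i‖ₑ ^ 2 := fun t => by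
    have := hx.measurable t
    fun_prop
  have hI0 : 0 ≤ ∫ h, Real.log (1 + ∑ i, ‖h i‖ ^ 2) ∂ν := integral_nonneg hlog0
  have hL0 := Real.log_nonneg hP
  calc ∑ t : Fin n, stepCost x P (primLaw π ν n) t b
      ≤ ∑ t : Fin n, ∫⁻ ω, (ENNReal.ofReal (Real.log P) +
        ENNReal.ofReal (Real.log (1 + ∑ i, ‖fading t b ω i‖ ^ 2)) +
          (∑ i, ‖x t ω i‖ₑ ^ 2) / ENNReal.ofReal P) ∂(primLaw π ν n) :=
        Finset.sum_le_sum fun t _ => lintegral_mono (key t)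
    _ = ∑ t : Fin n, (ENNReal.ofReal (Real.log P) +
          ENNReal.ofReal (∫ h, Real.log (1 + ∑ i, ‖h i‖ ^ 2) ∂ν) +
          (∫⁻ ω, ∑ i, ‖x t ω i‖ₑ ^ 2 ∂(primLaw π ν n)) / ENNReal.ofReal P) := by
        refine Finset.sum_congr rfl fun t _ => ?_
        rw [lintegral_add_right _ ((hxm t).div_const _), lintegral_add_left measurable_const,
          hfad, lintegral_const, measure_univ, mul_one]
        simp only [div_eq_mul_inv]
        rw [lintegral_mul_const _ (hxm t)]
    _ = n * (ENNReal.ofReal (Real.log P) +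
          ENNReal.ofReal (∫ h, Real.log (1 + ∑ i, ‖h i‖ ^ 2) ∂ν)) +
          (∫⁻ ω, ∑ t, ∑ i, ‖x t ω i‖ₑ ^ 2 ∂(primLaw π ν n)) / ENNReal.ofReal P := by
        rw [Finset.sum_add_distrib, lintegral_finsetSum _ fun t _ => hxm t]
        simp [div_eq_mul_inv, Finset.sum_mul, mul_add]
    _ ≤ n * (ENNReal.ofReal (Real.log P) +
          ENNReal.ofReal (∫ h, Real.log (1 + ∑ i, ‖h i‖ ^ 2) ∂ν)) + n := by
        gcongr
        refine ENNReal.div_le_of_le_mul hpow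
    _ = ENNReal.ofReal (n * (Real.log P + ∫ h, Real.log (1 + ∑ i, ‖h i‖ ^ 2) ∂ν + 1)) := by
        rw [ENNReal.ofReal_mul (Nat.cast_nonneg n), ENNReal.ofReal_add (add_nonneg hL0 hI0)
          zero_le_one, ENNReal.ofReal_add hL0 hI0, ENNReal.ofReal_natCast, ENNReal.ofReal_one,
          mul_add, mul_add, mul_one, mul_add]

end Converse

/-! ### The converse at finite block length. -/

section FiniteBlocklength

theorem map_comp_prodMk_eq_prod {Ω α β γ : Type*} [MeasurableSpace Ω] [MeasurableSpace α]
    [MeasurableSpace β] [MeasurableSpace γ] {μ : Measure Ω} [IsFiniteMeasure μ] {X : Ω → α}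
    (hX : Measurable X) {Y : Ω → β} (hY : Measurable Y) {r : Measure β} [IsFiniteMeasure r]
    (h : (μ.map fun ω => (X ω, Y ω)) = (μ.map X).prod r) {φ : α → γ} (hφ : Measurable φ) :
    (μ.map fun ω => (φ (X ω), Y ω)) = (μ.map fun ω => φ (X ω)).prod r := by
  have h1 := congrArg (Measure.map (Prod.map φ id)) h
  rw [Measure.map_map (hφ.prodMap measurable_id) (hX.prodMk hY), ← Measure.map_prod_map _ _ hφ
    measurable_id, Measure.map_id, Measure.map_map hφ hX] at h1
  exact h1

/-- Combination of the information inequalities behind the converse. -/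
theorem rate_bound_of_information_bounds {β₀ β₁ β₂ β₁₂ : ℝ≥0∞} {N a a' L' l : ℝ} (hN : 0 ≤ N)
    (hL' : 0 ≤ L') (hl : 0 ≤ l) (f₀ : β₀ ≤ ENNReal.ofReal N) (f₂ : β₂ ≤ ENNReal.ofReal N)
    (h₁ : 2 * ENNReal.ofReal a ≤ β₁ + ENNReal.ofReal N)
    (h₂ : 2 * β₂ + ENNReal.ofReal a ≤ β₁₂ + ENNReal.ofReal N)
    (h₃ : β₀ + ENNReal.ofReal a' ≤ β₂) (h₄ : β₁ ≤ β₀ + ENNReal.ofReal l)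
    (h₅ : β₁₂ ≤ β₁ + ENNReal.ofReal L') :
    3 * a + 2 * a' ≤ 2 * N + 2 * l + L' ∧ a' ≤ N := by
  have e₀ : β₀ ≠ ∞ := ne_top_of_le_ne_top ENNReal.ofReal_ne_top f₀
  have e₂ : β₂ ≠ ∞ := ne_top_of_le_ne_top ENNReal.ofReal_ne_top f₂
  have e₁ : β₁ ≠ ∞ := ne_top_of_le_ne_top (ENNReal.add_ne_top.2 ⟨e₀, ENNReal.ofReal_ne_top⟩) h₄
  have e₁₂ : β₁₂ ≠ ∞ := ne_top_of_le_ne_top (ENNReal.add_ne_top.2 ⟨e₁, ENNReal.ofReal_ne_top⟩) h₅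
  lift β₀ to ℝ≥0 using e₀
  lift β₁ to ℝ≥0 using e₁
  lift β₂ to ℝ≥0 using e₂
  lift β₁₂ to ℝ≥0 using e₁₂
  simp only [ENNReal.ofReal] at *
  norm_cast at f₀ f₂ h₁ h₂ h₃ h₄ h₅
  rw [← NNReal.coe_le_coe] at f₀ f₂ h₁ h₂ h₃ h₄ h₅
  push_cast [Real.coe_toNNReal N hN, Real.coe_toNNReal L' hL', Real.coe_toNNReal l hl] at *
  -- The Fano bounds a and a' may be negative; truncating them at 0 only increases them.
  have ha := Real.le_coe_toNNReal a
  have ha' := Real.le_coe_toNNReal a'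
  have := β₀.coe_nonneg
  -- The first bound is h₁ + h₂ + 2h₃ + 2h₄ + h₅; the second is h₃ with f₂ and β₀ ≥ 0.
  constructor <;> linarith

variable {Θ : Type*} [MeasurableSpace Θ] {M n : ℕ}
variable {x : Fin n → Primitives Θ M n → CVec M} (hx : IsCausalInput x) {P : ℝ}
  (π : Measure Θ) [IsProbabilityMeasure π] (ν : Measure (CVec M)) [IsProbabilityMeasure ν]

include hx

/-- Finite-blocklength form of the converse: user `b` decodes the message `A`, which leaks at most
`l` nats to user `!b`, who decodes the message `B`. -/
theorem finite_blocklength_converse (hP : 0 ≤ P) {m m' : ℕ} [NeZero m] [NeZero m']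
    {A : Θ → Fin m} (hA : Measurable A) {B : Θ → Fin m'} (hB : Measurable B)
    (hAB : (π.map fun θ => (A θ, B θ)) = (uniformOn Set.univ).prod (uniformOn Set.univ)) (b : Bool)
    {dA : (Fin n → (CVec M × ℂ) × CVec M) → Fin m} (hdA : Measurable dA)
    {dB : (Fin n → (CVec M × ℂ) × CVec M) → Fin m'} (hdB : Measurable dB) {ε l N : ℝ}
    (hεA : (primLaw π ν n).real {ω | dA (ownView x P b le_rfl ω) ≠ A ω.1} ≤ ε)
    (hεB : (primLaw π ν n).real {ω | dB (ownView x P (!b) le_rfl ω) ≠ B ω.1} ≤ ε)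
    (hl : 0 ≤ l) (hleak : klDiv ((primLaw π ν n).map fun ω => (A ω.1, ownView x P (!b) le_rfl ω))
      (((primLaw π ν n).map fun ω => A ω.1).prod
        ((primLaw π ν n).map (ownView x P (!b) le_rfl))) ≤ ENNReal.ofReal l)
    (hN : 0 ≤ N) (hcost : ∀ b, ∑ t, stepCost x P (primLaw π ν n) t b ≤ ENNReal.ofReal N) :
    (1 - ε) * (3 * Real.log m + 2 * Real.log m') ≤
        2 * N + 2 * l + Real.log m' + 5 * Real.log 2 ∧
      (1 - ε) * Real.log m' ≤ N + Real.log 2 := by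
  have : IsProbabilityMeasure (uniformOn (Set.univ : Set (Fin m))) :=
    isProbabilityMeasure_uniformOn Set.finite_univ Set.univ_nonempty
  have : IsProbabilityMeasure (uniformOn (Set.univ : Set (Fin m'))) :=
    isProbabilityMeasure_uniformOn Set.finite_univ Set.univ_nonempty
  have hb₁ : StandardBorelSpace ((CVec M × ℂ) × CVec M) := inferInstance
  have hb₂ : StandardBorelSpace ((CVec M × ℂ) × (CVec M × ℂ)) := inferInstance
  have : StandardBorelSpace (Fin n → (CVec M × ℂ) × CVec M) := StandardBorelSpace.pi_countable
  have : StandardBorelSpace (Fin n → (CVec M × ℂ) × (CVec M × ℂ)) :=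
    StandardBorelSpace.pi_countable
  set μ := primLaw π ν n with hμ
  set V := ownView x P b (le_refl n) with hVdef
  set V' := ownView x P (!b) (le_refl n) with hV'def
  set J := jointView x P b (le_refl n) with hJdef
  set J' := jointView x P (!b) (le_refl n) with hJ'def
  set q₁ : Measure (Fin n → (CVec M × ℂ) × CVec M) :=
    Measure.pi fun _ => (ν.prod complexGaussian).prod ν with hq₁
  set q₂ : Measure (Fin n → (CVec M × ℂ) × (CVec M × ℂ)) :=
    Measure.pi fun _ => (ν.prod complexGaussian).prod (ν.prod complexGaussian) with hq₂
  have hV : Measurable V := hx.measurable_ownView P b le_rfl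
  have hV' : Measurable V' := hx.measurable_ownView P (!b) le_rfl
  have hJ : Measurable J := hx.measurable_jointView P b le_rfl
  have hA' : Measurable fun ω : Primitives Θ M n => A ω.1 := hA.comp measurable_fst
  have hB' : Measurable fun ω : Primitives Θ M n => B ω.1 := hB.comp measurable_fst
  have hlaw : (μ.map fun ω => (A ω.1, B ω.1)) =
      (uniformOn Set.univ).prod (uniformOn Set.univ) := by
    have hfst : MeasurePreserving Prod.fst μ π := measurePreserving_fst
    rw [← hAB, ← hfst.map_eq, Measure.map_map (hA.prodMk hB) measurable_fst]
    rfl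
  have hlawA : (μ.map fun ω => A ω.1) = uniformOn Set.univ := by
    have := congrArg Measure.fst hlaw
    rwa [Measure.fst_map_prodMk hB', Measure.fst_prod] at this
  have hlawB : (μ.map fun ω => B ω.1) = uniformOn Set.univ := by
    have := congrArg Measure.snd hlaw
    rwa [Measure.snd_map_prodMk hA', Measure.snd_prod] at this
  have hindAB : (μ.map fun ω => (A ω.1, B ω.1)) =
      (μ.map fun ω => A ω.1).prod (uniformOn Set.univ) := by rw [hlawA, hlaw]
  have hindBA : (μ.map fun ω => (B ω.1, A ω.1)) =
      (μ.map fun ω => B ω.1).prod (uniformOn Set.univ) := by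
    have := congrArg (Measure.map Prod.swap) hlaw
    rwa [Measure.map_map measurable_swap (hA'.prodMk hB'), Measure.prod_swap, ← hlawB] at this
  -- Conditioning on the unit value makes unconditional divergences instances of `condDiv`.
  have hu : Measurable fun _ : Primitives Θ M n => () := measurable_const
  have huA : Measurable fun θ => ((), A θ) := measurable_const.prodMk hA
  have huB : Measurable fun θ => ((), B θ) := measurable_const.prodMk hB
  have huA' : Measurable fun ω : Primitives Θ M n => ((), A ω.1) := huA.comp measurable_fst
  have huB' : Measurable fun ω : Primitives Θ M n => ((), B ω.1) := huB.comp measurable_fst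
  have hAlone := map_comp_prodMk_eq_prod hB' hA' hindBA (φ := fun _ => ()) measurable_const
  have hBlone := map_comp_prodMk_eq_prod hA' hB' hindAB (φ := fun _ => ()) measurable_const
  have hAB' := map_comp_prodMk_eq_prod hA' hB' hindAB (φ := fun a => ((), a)) (by fun_prop)
  have hBA' := map_comp_prodMk_eq_prod hB' hA' hindBA (φ := fun a => ((), a)) (by fun_prop)
  -- In each identity the last term is the information that the conditioning and the view carry
  -- about a message: Fano bounds it below; secrecy or the message size bounds it above.
  have chainA := condDiv_prod_left (q := q₁) hu hV hA' (uniformOn Set.univ) hAlone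
  have chainA' := condDiv_prod_left (q := q₁) hu hV' hA' (uniformOn Set.univ) hAlone
  have chainB' := condDiv_prod_left (q := q₁) hu hV' hB' (uniformOn Set.univ) hBlone
  have chainAB' := condDiv_prod_left (q := q₁) huA' hV' hB' (uniformOn Set.univ) hAB'
  have chainBA := condDiv_prod_left (q := q₂) huB' hJ hA' (uniformOn Set.univ) hBA'
  have fanoA := fano_le_condDiv (μ := μ) (F := fun ω => ((), V ω)) (hu.prodMk hV) hA'
    (d := fun p => dA p.2) (by fun_prop) hεA
  have fanoB := fano_le_condDiv (μ := μ) (F := fun ω => ((), V' ω)) (hu.prodMk hV') hB'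
    (d := fun p => dB p.2) (by fun_prop) hεB
  -- The joint view contains the view of user b, whose decoder still applies and ignores B.
  have fanoJ := fano_le_condDiv (μ := μ) (F := fun ω => (((), B ω.1), J ω)) (huB'.prodMk hJ) hA'
    (d := fun p => dA fun i => ((p.2 i).1, (p.2 i).2.1)) (by fun_prop) hεA
  have domB := condDiv_uniformOn_le (μ := μ) (F := fun ω => (((), A ω.1), V' ω))
    (huA'.prodMk hV') hB'
  have leakA : condDiv μ (fun ω => ((), V' ω)) (fun ω => A ω.1) (uniformOn Set.univ) ≤
      ENNReal.ofReal l := by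
    refine (condDiv_comp_left_le (μ := μ) hV' hA' (φ := fun v => ((), v)) (by fun_prop)).trans
      (le_trans ?_ hleak)
    have : IsProbabilityMeasure (μ.map V') := Measure.isProbabilityMeasure_map hV'.aemeasurable
    have h := klDiv_map_le (μ.map fun ω => (A ω.1, V' ω)) ((μ.map fun ω => A ω.1).prod (μ.map V'))
      measurable_swap
    rw [Measure.map_map measurable_swap (hA'.prodMk hV'), hlawA, Measure.prod_swap] at h
    rw [hlawA]
    exact h
  have symA : 2 * condDiv μ (fun ω => ((), A ω.1)) V q₁ ≤
      condDiv μ (fun ω => ((), A ω.1)) V' q₁ + ENNReal.ofReal N := by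
    refine (two_mul_condDiv_ownView_le hx P π ν huA b (le_refl n)).trans ?_
    refine (condDiv_jointView_not_le hx π ν huA b).trans ?_
    refine (condDiv_jointView_le hx π ν hP huA !b).trans ?_
    gcongr
    exact hcost _
  have symB : 2 * condDiv μ (fun ω => ((), B ω.1)) V' q₁ ≤
      condDiv μ (fun ω => ((), B ω.1)) J q₂ := by
    refine (two_mul_condDiv_ownView_le hx P π ν huB (!b) (le_refl n)).trans ?_
    simpa only [Bool.not_not] using condDiv_jointView_not_le hx π ν huB !b
  have extAB : condDiv μ (fun ω => (((), B ω.1), A ω.1)) J q₂ ≤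
      condDiv μ (fun ω => (((), A ω.1), B ω.1)) V' q₁ + ENNReal.ofReal N := by
    refine (condDiv_comp_left_le (μ := μ) (huA'.prodMk hB') hJ
      (φ := fun p => (((), p.2), p.1.2)) (by fun_prop)).trans ?_
    refine (condDiv_jointView_not_le hx π ν (huA.prodMk hB) b).trans ?_
    refine (condDiv_jointView_le hx π ν hP (huA.prodMk hB) !b).trans ?_
    gcongr
    exact hcost _
  have fin₀ := (condDiv_ownView_le hx π ν hP (F := fun _ => ()) measurable_const (!b)
    (le_refl n)).trans (hcost !b)
  have fin₂ := (condDiv_ownView_le hx π ν hP huB (!b) (le_refl n)).trans (hcost !b)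
  have hm' : 0 ≤ Real.log m' := Real.log_natCast_nonneg m'
  have key := rate_bound_of_information_bounds
    (β₁ := condDiv μ (fun ω => ((), A ω.1)) V' q₁)
    (β₁₂ := condDiv μ (fun ω => (((), A ω.1), B ω.1)) V' q₁)
    (a := (1 - ε) * Real.log m - Real.log 2) (a' := (1 - ε) * Real.log m' - Real.log 2)
    hN hm' hl fin₀ fin₂ ?_ ?_ ?_ ?_ ?_
  · obtain ⟨h1, h2⟩ := key
    constructor <;> linarith
  · refine le_trans ?_ symA
    gcongr
    rw [chainA]
    exact fanoA.trans le_add_self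
  · refine le_trans ?_ extAB
    rw [chainBA]
    exact add_le_add symB fanoJ
  · rw [chainB']
    exact add_le_add le_rfl fanoB
  · rw [chainA']
    exact add_le_add le_rfl leakA
  · rw [chainAB']
    exact add_le_add le_rfl domB

end FiniteBlocklength

/-! ### From codes to the abstract channel model. -/

theorem measurePreserving_mergeBool {ι A : Type*} [Fintype ι] [MeasurableSpace A] (α : Measure A)
    [IsProbabilityMeasure α] :
    MeasurePreserving (fun (p : (ι → A) × (ι → A)) (j : ι × Bool) => cond j.2 (p.1 j.1) (p.2 j.1))
      ((Measure.pi fun _ => α).prod (Measure.pi fun _ => α)) (Measure.pi fun _ => α) := by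
  have hmeas : Measurable fun (p : (ι → A) × (ι → A)) (j : ι × Bool) =>
      cond j.2 (p.1 j.1) (p.2 j.1) :=
    measurable_pi_iff.2 fun ⟨i, b⟩ => by cases b <;> simp only [cond_true, cond_false] <;> fun_prop
  refine ⟨hmeas, (Measure.pi_eq fun s hs => ?_).symm⟩
  rw [Measure.map_apply hmeas (MeasurableSet.univ_pi hs)]
  have : (fun (p : (ι → A) × (ι → A)) (j : ι × Bool) => cond j.2 (p.1 j.1) (p.2 j.1)) ⁻¹'
      Set.univ.pi s =
      (Set.univ.pi fun i => s (i, true)) ×ˢ (Set.univ.pi fun i => s (i, false)) := by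
    ext ⟨f, g⟩
    simp [Set.mem_pi, forall_and, and_comm]
  rw [this, Measure.prod_prod, Measure.pi_pi, Measure.pi_pi, Fintype.prod_prod_type,
    ← Finset.prod_mul_distrib]
  simp

namespace Code

variable {M n : ℕ} (C : Code M n) (ν : Measure (CVec M)) [IsProbabilityMeasure ν] (P : ℝ)

instance : NeZero C.m₁ := ⟨C.m₁_pos.ne'⟩

instance : NeZero C.m₂ := ⟨C.m₂_pos.ne'⟩

instance : IsProbabilityMeasure (uniformOn (Set.univ : Set (Fin C.m₁))) :=
  isProbabilityMeasure_uniformOn Set.finite_univ Set.univ_nonempty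

instance : IsProbabilityMeasure (uniformOn (Set.univ : Set (Fin C.m₂))) :=
  isProbabilityMeasure_uniformOn Set.finite_univ Set.univ_nonempty

/-- The joint law of the messages and the seed. -/
def transmitterLaw : Measure ((Fin C.m₁ × Fin C.m₂) × C.Seed) :=
  ((uniformOn Set.univ).prod (uniformOn Set.univ)).prod C.seedLaw

instance : IsProbabilityMeasure C.transmitterLaw := by
  unfold transmitterLaw; infer_instance

/-- The primitive random variables of a code, with user 1 labelled `true`. -/
def primitives (ω : C.Sample) : Primitives ((Fin C.m₁ × Fin C.m₂) × C.Seed) M n :=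
  ((ω.1, ω.2.1), fun j => (cond j.2 (C.H ω j.1) (C.G ω j.1), cond j.2 (C.E ω j.1) (C.B ω j.1)))

theorem measurePreserving_primitives :
    MeasurePreserving C.primitives (C.law ν) (primLaw C.transmitterLaw ν n) := by
  have h1 := (measurePreserving_mergeBool (ι := Fin n) ν).prod
    (measurePreserving_mergeBool (ι := Fin n) complexGaussian)
  have h2 := (measurePreserving_zipWith (ι := Fin n × Bool) ν complexGaussian
    (ν.prod complexGaussian) (κ := fun p => p) (MeasurePreserving.id _)).comp h1
  have h3 := ((MeasurePreserving.id C.transmitterLaw).prod h2).comp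
    (MeasurePreserving.symm _ (measurePreserving_prodAssoc
      ((uniformOn (Set.univ : Set (Fin C.m₁))).prod (uniformOn (Set.univ : Set (Fin C.m₂))))
      C.seedLaw _))
  exact h3

/-- The input process of a code as a function of the primitive random variables. -/
def input (t : Fin n) (ω : Primitives ((Fin C.m₁ × Fin C.m₂) × C.Seed) M n) : CVec M :=
  C.enc t (ω.1.1.1, ω.1.1.2, ω.1.2, fun s => (ω.2 (Fin.castLE t.isLt.le s, true)).1,
    fun s => (ω.2 (Fin.castLE t.isLt.le s, false)).1)

theorem isCausalInput_input : IsCausalInput C.input where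
  measurable t := by
    refine (C.measurable_enc t).comp ?_
    fun_prop
  congr t θ f f' h := by
    have h' : ∀ (s : Fin (t : ℕ)) b,
        (f (Fin.castLE t.isLt.le s, b)).1 = (f' (Fin.castLE t.isLt.le s, b)).1 := fun s b =>
      h _ (show (s : ℕ) < t from s.isLt) b
    simp only [input, h']

theorem input_primitives (ω : C.Sample) (t : Fin n) : C.input t (C.primitives ω) = C.X ω t := rfl

/-- What a receiver observes: its outputs and all channel vectors. -/
def observation (b : Bool) (ω : C.Sample) : (Fin n → ℂ) × (Fin n → CVec M) × (Fin n → CVec M) :=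
  (cond b (C.Y ω) (C.Z ω), C.H ω, C.G ω)

end Code

variable {M n : ℕ}

/-- Normalization of the observation of a receiver. -/
def normalizeView (P : ℝ) (b : Bool) (p : (Fin n → ℂ) × (Fin n → CVec M) × (Fin n → CVec M))
    (t : Fin n) : (CVec M × ℂ) × CVec M :=
  ((cond b p.2.1 p.2.2 t, gain P (cond b p.2.1 p.2.2 t) * p.1 t), cond b p.2.2 p.2.1 t)

/-- Inverse of the normalization of the observation of a receiver. -/
def denormalizeView (P : ℝ) (b : Bool) (v : Fin n → (CVec M × ℂ) × CVec M) :
    (Fin n → ℂ) × (Fin n → CVec M) × (Fin n → CVec M) :=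
  (fun t => (v t).1.2 / gain P (v t).1.1, fun t => cond b (v t).1.1 (v t).2,
    fun t => cond b (v t).2 (v t).1.1)

/-- The gain never vanishes, so scaling loses no information and decoders can be run on scaled
views. -/
theorem denormalizeView_normalizeView {P : ℝ} (hP : 0 ≤ P) (b : Bool)
    (p : (Fin n → ℂ) × (Fin n → CVec M) × (Fin n → CVec M)) :
    denormalizeView P b (normalizeView P b p) = p := by
  have h : ∀ h : CVec M, (gain P h : ℂ) ≠ 0 := fun h => by
    exact_mod_cast (gain_pos hP h).ne'
  cases b <;> simp [denormalizeView, normalizeView, h]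

theorem measurable_normalizeView (P : ℝ) (b : Bool) :
    Measurable (normalizeView (M := M) (n := n) P b) := by
  refine measurable_pi_iff.2 fun t => ?_
  cases b <;> simp only [normalizeView, cond_true, cond_false] <;> fun_prop

theorem measurable_denormalizeView (P : ℝ) (b : Bool) :
    Measurable (denormalizeView (M := M) (n := n) P b) := by
  have h : Measurable fun p : CVec M × ℂ => p.2 / (gain P p.1 : ℂ) := by fun_prop
  have h' : ∀ t, Measurable fun v : Fin n → (CVec M × ℂ) × CVec M =>
      (v t).1.2 / (gain P (v t).1.1 : ℂ) := fun t =>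
    h.comp (measurable_fst.comp (measurable_pi_apply t))
  refine (measurable_pi_iff.2 h').prodMk ?_
  cases b <;> simp only [cond_true, cond_false] <;> fun_prop

namespace Code

variable (C : Code M n) (ν : Measure (CVec M)) [IsProbabilityMeasure ν] (P : ℝ)

theorem ownView_primitives (b : Bool) (ω : C.Sample) :
    ownView C.input P b le_rfl (C.primitives ω) = normalizeView P b (C.observation b ω) := by
  ext1 t
  cases b
  · simp [ownView, normalizeView, received, output, signal, observation, fading, noise, primitives,
      Z, mul_add, ← input_primitives]
  · simp [ownView, normalizeView, received, output, signal, observation, fading, noise, primitives,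
      Y, mul_add, ← input_primitives]

theorem measurable_observation (b : Bool) : Measurable (C.observation b) := by
  have hX : ∀ t, Measurable fun ω => C.X ω t := fun t => by
    refine (C.measurable_enc t).comp ?_
    unfold W₁ W₂ H G
    fun_prop
  have hY : Measurable C.Y := measurable_pi_iff.2 fun t => by
    have := hX t
    unfold Y H E dotProduct
    fun_prop
  have hZ : Measurable C.Z := measurable_pi_iff.2 fun t => by
    have := hX t
    unfold Z G B dotProduct
    fun_prop
  have hH : Measurable C.H := by unfold H; fun_prop
  have hG : Measurable C.G := by unfold G; fun_prop
  cases b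
  · exact hZ.prodMk (hH.prodMk hG)
  · exact hY.prodMk (hH.prodMk hG)

variable {P}

/-- Transfer to the sample space of a code: decoders act after `denormalizeView`, leakage cannot
grow under `normalizeView`, and the factor `Real.log 2` turns bits into nats. The messages A and B
stay abstract so that both assignments of roles are covered. -/
theorem rate_bound (hP : 1 ≤ P)
    (hν : Integrable (fun h : CVec M => Real.log (1 + ∑ i, ‖h i‖ ^ 2)) ν)
    (hpow : C.PowerConstraint ν P) (b : Bool) {m m' : ℕ} [NeZero m] [NeZero m']
    {A : (Fin C.m₁ × Fin C.m₂) × C.Seed → Fin m} (hA : Measurable A)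
    {B : (Fin C.m₁ × Fin C.m₂) × C.Seed → Fin m'} (hB : Measurable B)
    (hAB : (C.transmitterLaw.map fun θ => (A θ, B θ)) =
      (uniformOn Set.univ).prod (uniformOn Set.univ))
    {dA : (Fin n → ℂ) × (Fin n → CVec M) × (Fin n → CVec M) → Fin m} (hdA : Measurable dA)
    {dB : (Fin n → ℂ) × (Fin n → CVec M) × (Fin n → CVec M) → Fin m'} (hdB : Measurable dB)
    {ε l : ℝ} (hεA : (C.law ν).real {ω | dA (C.observation b ω) ≠ A (ω.1, ω.2.1)} ≤ ε)
    (hεB : (C.law ν).real {ω | dB (C.observation (!b) ω) ≠ B (ω.1, ω.2.1)} ≤ ε) (hl : 0 ≤ l)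
    (hleak : mutualInfo (C.law ν) (fun ω => A (ω.1, ω.2.1)) (C.observation !b) ≤
      ENNReal.ofReal l) :
    (1 - ε) * (3 * Real.log m + 2 * Real.log m') ≤
        2 * (n * (Real.log P + ∫ h, Real.log (1 + ∑ i, ‖h i‖ ^ 2) ∂ν + 1)) +
          2 * (l * Real.log 2) + Real.log m' + 5 * Real.log 2 ∧
      (1 - ε) * Real.log m' ≤
        n * (Real.log P + ∫ h, Real.log (1 + ∑ i, ‖h i‖ ^ 2) ∂ν + 1) + Real.log 2 := by
  have hP0 : 0 ≤ P := by linarith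
  have hx := C.isCausalInput_input
  have hΦ := C.measurePreserving_primitives ν
  have hlog2 : 0 < Real.log 2 := Real.log_pos one_lt_two
  have hprob : IsProbabilityMeasure (C.law ν) := by unfold law; infer_instance
  have hI : 0 ≤ ∫ h : CVec M, Real.log (1 + ∑ i, ‖h i‖ ^ 2) ∂ν := integral_nonneg fun h =>
    Real.log_nonneg (by linarith [Finset.sum_nonneg fun i (_ : i ∈ Finset.univ) => sq_nonneg ‖h i‖])
  have herr : ∀ (c : Bool) {k : ℕ} {D : (Fin C.m₁ × Fin C.m₂) × C.Seed → Fin k}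
      (_ : Measurable D) {d : (Fin n → ℂ) × (Fin n → CVec M) × (Fin n → CVec M) → Fin k}
      (_ : Measurable d), (primLaw C.transmitterLaw ν n).real
        {ω | d (denormalizeView P c (ownView C.input P c le_rfl ω)) ≠ D ω.1} =
        (C.law ν).real {ω | d (C.observation c ω) ≠ D (ω.1, ω.2.1)} := by
    intro c k D hD d hd
    have hS : MeasurableSet {ω : Primitives ((Fin C.m₁ × Fin C.m₂) × C.Seed) M n |
        d (denormalizeView P c (ownView C.input P c le_rfl ω)) ≠ D ω.1} :=
      (measurableSet_eq_fun ((hd.comp (measurable_denormalizeView P c)).comp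
        (hx.measurable_ownView P c le_rfl)) (hD.comp measurable_fst)).compl
    rw [measureReal_def, ← hΦ.measure_preimage hS.nullMeasurableSet, ← measureReal_def]
    congr 1
    ext ω
    simp only [Set.mem_preimage, Set.mem_ofPred_eq, ownView_primitives,
      denormalizeView_normalizeView hP0]
    rfl
  refine finite_blocklength_converse hx C.transmitterLaw ν hP0 hA hB hAB b
    (hdA.comp (measurable_denormalizeView P b)) (hdB.comp (measurable_denormalizeView P !b))
    ((herr b hA hdA).le.trans hεA) ((herr (!b) hB hdB).le.trans hεB)
    (mul_nonneg hl hlog2.le) ?_ (by have := Real.log_nonneg hP; positivity) fun c => ?_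
  · have hO := C.measurable_observation !b
    have hA' : Measurable fun ω : C.Sample => A (ω.1, ω.2.1) := hA.comp (by fun_prop)
    have hA'' : Measurable fun ω : Primitives ((Fin C.m₁ × Fin C.m₂) × C.Seed) M n => A ω.1 :=
      hA.comp measurable_fst
    have hV := hx.measurable_ownView P (!b) (le_refl n)
    have hnv := measurable_normalizeView (M := M) (n := n) P !b
    have := Measure.isProbabilityMeasure_map (μ := C.law ν) hA'.aemeasurable
    have := Measure.isProbabilityMeasure_map (μ := C.law ν) hO.aemeasurable
    have hle := klDiv_map_le ((C.law ν).map fun ω => (A (ω.1, ω.2.1), C.observation (!b) ω))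
      (((C.law ν).map fun ω => A (ω.1, ω.2.1)).prod ((C.law ν).map (C.observation !b)))
      (measurable_id.prodMap hnv)
    rw [Measure.map_map (measurable_id.prodMap hnv) (hA'.prodMk hO),
      ← Measure.map_prod_map _ _ measurable_id hnv, Measure.map_id, Measure.map_map hnv hO] at hle
    have e : ownView C.input P (!b) le_rfl ∘ C.primitives =
        normalizeView P (!b) ∘ C.observation !b := funext (C.ownView_primitives P !b)
    rw [← hΦ.map_eq, Measure.map_map (hA''.prodMk hV) hΦ.measurable,
      Measure.map_map hV hΦ.measurable, Measure.map_map hA'' hΦ.measurable, e]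
    rw [mutualInfo, ENNReal.div_le_iff (by simpa using hlog2) ENNReal.ofReal_ne_top,
      ← ENNReal.ofReal_mul hl] at hleak
    refine le_trans (le_of_eq ?_) (hle.trans hleak)
    congr 2
    ext ω : 1
    exact Prod.ext rfl (C.ownView_primitives P (!b) ω)
  · refine sum_stepCost_le hx C.transmitterLaw ν hP hν ?_ c
    have hm : Measurable fun ω => ∑ t, ∑ i, ‖C.input t ω i‖ₑ ^ 2 := by
      have := hx.measurable
      fun_prop
    rw [← hΦ.lintegral_comp hm]
    exact hpow

end Code

namespace Code

variable {M n : ℕ} (C : Code M n) (ν : Measure (CVec M)) [IsProbabilityMeasure ν] {P : ℝ}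

theorem map_messages_transmitterLaw :
    (C.transmitterLaw.map fun θ => (θ.1.1, θ.1.2)) =
      (uniformOn Set.univ).prod (uniformOn Set.univ) :=
  (measurePreserving_fst (ν := C.seedLaw)).map_eq

theorem map_messages_swap_transmitterLaw :
    (C.transmitterLaw.map fun θ => (θ.1.2, θ.1.1)) =
      (uniformOn Set.univ).prod (uniformOn Set.univ) :=
  (Measure.measurePreserving_swap.comp (measurePreserving_fst (ν := C.seedLaw))).map_eq

theorem rate_bound₁ (hP : 1 ≤ P)
    (hν : Integrable (fun h : CVec M => Real.log (1 + ∑ i, ‖h i‖ ^ 2)) ν)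
    (hpow : C.PowerConstraint ν P) {ε l : ℝ} (hε : (C.errorProb ν).toReal ≤ ε) (hl : 0 ≤ l)
    (hleak : C.leakage₁ ν ≤ ENNReal.ofReal l) :
    (1 - ε) * (3 * Real.log C.m₁ + 2 * Real.log C.m₂) ≤
        2 * (n * (Real.log P + ∫ h, Real.log (1 + ∑ i, ‖h i‖ ^ 2) ∂ν + 1)) +
          2 * (l * Real.log 2) + Real.log C.m₂ + 5 * Real.log 2 ∧
      (1 - ε) * Real.log C.m₂ ≤
        n * (Real.log P + ∫ h, Real.log (1 + ∑ i, ‖h i‖ ^ 2) ∂ν + 1) + Real.log 2 := by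
  have hprob : IsProbabilityMeasure (C.law ν) := by unfold law; infer_instance
  refine C.rate_bound ν hP hν hpow true (A := fun θ => θ.1.1) (by fun_prop) (B := fun θ => θ.1.2)
    (by fun_prop) C.map_messages_transmitterLaw C.measurable_dec₁ C.measurable_dec₂
    (le_trans ?_ hε) (le_trans ?_ hε) hl hleak
  · exact measureReal_mono fun ω hω => Or.inl hω
  · exact measureReal_mono fun ω hω => Or.inr hω

theorem rate_bound₂ (hP : 1 ≤ P)
    (hν : Integrable (fun h : CVec M => Real.log (1 + ∑ i, ‖h i‖ ^ 2)) ν)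
    (hpow : C.PowerConstraint ν P) {ε l : ℝ} (hε : (C.errorProb ν).toReal ≤ ε) (hl : 0 ≤ l)
    (hleak : C.leakage₂ ν ≤ ENNReal.ofReal l) :
    (1 - ε) * (3 * Real.log C.m₂ + 2 * Real.log C.m₁) ≤
        2 * (n * (Real.log P + ∫ h, Real.log (1 + ∑ i, ‖h i‖ ^ 2) ∂ν + 1)) +
          2 * (l * Real.log 2) + Real.log C.m₁ + 5 * Real.log 2 ∧
      (1 - ε) * Real.log C.m₁ ≤
        n * (Real.log P + ∫ h, Real.log (1 + ∑ i, ‖h i‖ ^ 2) ∂ν + 1) + Real.log 2 := by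
  have hprob : IsProbabilityMeasure (C.law ν) := by unfold law; infer_instance
  refine C.rate_bound ν hP hν hpow false (A := fun θ => θ.1.2) (by fun_prop) (B := fun θ => θ.1.1)
    (by fun_prop) C.map_messages_swap_transmitterLaw C.measurable_dec₂ C.measurable_dec₁
    (le_trans ?_ hε) (le_trans ?_ hε) hl hleak
  · exact measureReal_mono fun ω hω => Or.inr hω
  · exact measureReal_mono fun ω hω => Or.inl hω

end Code

/-! ### The limits in block length and power. -/

/-- Passage from finite-blocklength rate bounds to degrees of freedom. -/
theorem dof_bound_of_rate_bound {m m' : ℝ → ℕ → ℕ} {err leak : ℝ → ℕ → ℝ≥0∞} {K d d' : ℝ}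
    (hbound : ∀ P, 1 ≤ P → ∀ n, ∀ ε l : ℝ, (err P n).toReal ≤ ε → 0 ≤ l →
      leak P n ≤ ENNReal.ofReal l →
      (1 - ε) * (3 * Real.log (m P n) + 2 * Real.log (m' P n)) ≤
        2 * (n * (Real.log P + K)) + 2 * (l * Real.log 2) + Real.log (m' P n) + 5 * Real.log 2 ∧
      (1 - ε) * Real.log (m' P n) ≤ n * (Real.log P + K) + Real.log 2)
    (herr : ∀ P, 0 < P → Tendsto (err P) atTop (𝓝 0))
    (hr : (d : EReal) ≤ liminf (fun P : ℝ => liminf (fun n : ℕ =>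
      ((Real.logb 2 (m P n) / n / Real.logb 2 P : ℝ) : EReal)) atTop) atTop)
    (hr' : (d' : EReal) ≤ liminf (fun P : ℝ => liminf (fun n : ℕ =>
      ((Real.logb 2 (m' P n) / n / Real.logb 2 P : ℝ) : EReal)) atTop) atTop)
    (hleak : Tendsto (fun P : ℝ => limsup (fun n : ℕ =>
      leak P n / n / ENNReal.ofReal (Real.logb 2 P)) atTop) atTop (𝓝 0)) :
    3 * d + d' ≤ 2 := by
  by_contra! hlt
  set D := 3 * d + d' with hD
  have hd : 0 < D := by linarith
  -- One δ serves for every approximation. The end result is (1 − δ)(D − 4δ) ≤ 2 + 9δ, so D − 2 ≤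
  -- (13 + D)δ − 4δ², and this δ makes (13 + D)δ half of D − 2.
  set δ := (D - 2) / (2 * (13 + D)) with hδdef
  have hδ : 0 < δ := by rw [hδdef]; apply div_pos <;> linarith
  have hδ' : δ ≤ 1 / 2 := by
    rw [hδdef, div_le_iff₀ (by linarith)]; linarith
  have hδD : δ * (13 + D) < D - 2 := by
    have : δ * (13 + D) = (D - 2) / 2 := by rw [hδdef]; field_simp
    linarith
  have lower : ∀ {c : ℝ} {k : ℝ → ℕ → ℕ}, (c : EReal) ≤ liminf (fun P : ℝ => liminf (fun n : ℕ =>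
      ((Real.logb 2 (k P n) / n / Real.logb 2 P : ℝ) : EReal)) atTop) atTop →
      ∀ᶠ P in atTop, ∀ᶠ n in atTop, c - δ < Real.logb 2 (k P n) / (n : ℕ) / Real.logb 2 P := by
    intro c k hk
    have h1 : ((c - δ : ℝ) : EReal) < liminf (fun P : ℝ => liminf (fun n : ℕ =>
      ((Real.logb 2 (k P n) / n / Real.logb 2 P : ℝ) : EReal)) atTop) atTop :=
      lt_of_lt_of_le (EReal.coe_lt_coe_iff.2 (by linarith)) hk
    filter_upwards [eventually_lt_of_lt_liminf h1] with P hP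
    filter_upwards [eventually_lt_of_lt_liminf hP] with n hn
    exact EReal.coe_lt_coe_iff.1 hn
  have hleak' : ∀ᶠ P in atTop, limsup (fun n : ℕ =>
      leak P n / n / ENNReal.ofReal (Real.logb 2 P)) atTop < ENNReal.ofReal δ :=
    hleak.eventually_lt_const (by simpa using hδ)
  have hlogP : ∀ᶠ P in atTop, K / δ ≤ Real.log P :=
    Real.tendsto_log_atTop.eventually_ge_atTop _
  obtain ⟨P, h1, h2, h3, h4, hP⟩ := ((lower hr).and ((lower hr').and (hleak'.and
    (hlogP.and (eventually_gt_atTop 1))))).exists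
  have hlog2 : 0 < Real.log 2 := Real.log_pos one_lt_two
  have hl : 0 < Real.log P := Real.log_pos hP
  have h5 : ∀ᶠ n in atTop, err P n < ENNReal.ofReal δ :=
    (herr P (by linarith)).eventually_lt_const (by simpa using hδ)
  have h6 : ∀ᶠ n : ℕ in atTop, 5 * Real.log 2 / (δ * Real.log P) ≤ n :=
    tendsto_natCast_atTop_atTop.eventually_ge_atTop _
  obtain ⟨n, h1, h2, h3, h5, h6, hn⟩ := (h1.and (h2.and ((eventually_lt_of_limsup_lt h3).and
    (h5.and (h6.and (eventually_ge_atTop 1)))))).exists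
  have hn0 : (0 : ℝ) < n := by exact_mod_cast hn
  have hlb : 0 < Real.logb 2 P := Real.logb_pos one_lt_two hP
  have hrate : ∀ (k : ℕ) (c : ℝ), c < Real.logb 2 k / n / Real.logb 2 P →
      c * (n * Real.log P) < Real.log k := by
    intro k c h
    have : Real.logb 2 k / n / Real.logb 2 P = Real.log k / (n * Real.log P) := by
      rw [Real.logb, Real.logb]; field_simp
    rwa [this, lt_div_iff₀ (mul_pos hn0 hl)] at h
  have hL := hrate _ _ h1
  have hL' := hrate _ _ h2
  have hε : (err P n).toReal ≤ δ := ENNReal.toReal_le_of_le_ofReal hδ.le h5.le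
  have hlk : leak P n ≤ ENNReal.ofReal (δ * Real.logb 2 P * n) := by
    have hn' : (n : ℝ≥0∞) ≠ 0 := by exact_mod_cast (by omega : n ≠ 0)
    rw [ENNReal.ofReal_mul (by positivity), ENNReal.ofReal_mul hδ.le, ENNReal.ofReal_natCast,
      ← ENNReal.div_le_iff hn' (ENNReal.natCast_ne_top n),
      ← ENNReal.div_le_iff (by simpa using hlb) ENNReal.ofReal_ne_top]
    exact h3.le
  obtain ⟨b1, b2⟩ := hbound P hP.le n δ _ hε (by positivity) hlk
  have hll : δ * Real.logb 2 P * n * Real.log 2 = δ * (n * Real.log P) := by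
    rw [Real.logb]; field_simp
  rw [hll] at b1
  set X := (n : ℝ) * Real.log P with hX
  have hX0 : 0 < X := mul_pos hn0 hl
  have hK : n * (Real.log P + K) ≤ X + δ * X := by
    have : K ≤ δ * Real.log P := by
      rw [div_le_iff₀ hδ] at h4; linarith
    have := mul_le_mul_of_nonneg_left this hn0.le
    rw [mul_add]
    nlinarith
  have h2' : 5 * Real.log 2 ≤ δ * X := by
    rw [div_le_iff₀ (mul_pos hδ hl)] at h6
    linarith
  -- An a priori bound on the second rate is needed because the error probability multiplies it; 1 −
  -- δ ≥ 1/2 makes the crude constant 4 sufficient.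
  have hB : Real.log (m' P n) ≤ 4 * X := by
    have hpos : 0 ≤ Real.log (m' P n) := Real.log_natCast_nonneg _
    have e1 : δ * X ≤ 1 / 2 * X := mul_le_mul_of_nonneg_right hδ' hX0.le
    have e2 : δ * Real.log (m' P n) ≤ 1 / 2 * Real.log (m' P n) :=
      mul_le_mul_of_nonneg_right hδ' hpos
    linarith
  have hB' : δ * Real.log (m' P n) ≤ δ * (4 * X) := mul_le_mul_of_nonneg_left hB hδ.le
  have hsum : (1 - δ) * (3 * ((d - δ) * X) + (d' - δ) * X) ≤
      (1 - δ) * (3 * Real.log (m P n) + Real.log (m' P n)) :=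
    mul_le_mul_of_nonneg_left (by linarith) (by linarith)
  -- The 9δ consists of 2δ from K, 2δ from the leakage, δ from the constant 5 log 2 and 4δ from δ
  -- log m'. The 4δ on the left is the loss 3δ + δ in the two rates.
  have hfin : (1 - δ) * (D - 4 * δ) * X ≤ (2 + 9 * δ) * X := by
    have e : (1 - δ) * (3 * ((d - δ) * X) + (d' - δ) * X) = (1 - δ) * (D - 4 * δ) * X := by
      rw [hD]; ring
    rw [← e]
    linarith
  have := le_of_mul_le_mul_right hfin hX0
  nlinarith [sq_nonneg δ]

end

end MISOBCC

theorem theorem4 (M : ℕ) (ν : Measure (MISOBCC.CVec M)) [IsProbabilityMeasure ν]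
    (hν : Integrable (fun h : MISOBCC.CVec M => Real.log (1 + ∑ i, ‖h i‖ ^ 2)) ν) :
    MISOBCC.sdofRegion M ν ⊆
      {d : ℝ × ℝ | 0 ≤ d.1 ∧ 0 ≤ d.2 ∧ 3 * d.1 + d.2 ≤ 2 ∧ d.1 + 3 * d.2 ≤ 2} := by
  refine closure_minimal ?_ ?_
  · rintro ⟨d₁, d₂⟩ ⟨h₁, h₂, C, hpow, herr, hr₁, hr₂, hl₁, hl₂⟩
    have key₁ := MISOBCC.dof_bound_of_rate_bound (fun P hP n ε l hε hl hleak => by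
      simpa only [add_assoc] using
        (C P n).rate_bound₁ ν hP hν (hpow P (by linarith) n) hε hl hleak) herr hr₁ hr₂ hl₁
    -- The same bound with the two users exchanged.
    have key₂ := MISOBCC.dof_bound_of_rate_bound (fun P hP n ε l hε hl hleak => by
      simpa only [add_assoc] using
        (C P n).rate_bound₂ ν hP hν (hpow P (by linarith) n) hε hl hleak) herr hr₂ hr₁ hl₂
    exact ⟨h₁, h₂, key₁, by linarith⟩
  · exact (isClosed_le continuous_const continuous_fst).inter
      ((isClosed_le continuous_const continuous_snd).inter
        ((isClosed_le (f := fun d : ℝ × ℝ => 3 * d.1 + d.2) (by fun_prop) continuous_const).inter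
          (isClosed_le (f := fun d : ℝ × ℝ => d.1 + 3 * d.2) (by fun_prop) continuous_const)))
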